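/- Let $k$ be a field of characteristic zero, let $n\ge 3$, and let $q\in k$ be a primitive $n$-th root of unity. Let $$H=k\langle x,y\mid x^n=1,\ yx=q\,xy,\ y^n=0\rangle$$ be the Taft algebra, of dimension $n^2$ with basis $\{x^iy^j\}_{0\le i,j<n}$; it is a Hopf algebra with $\Delta(x)=x\otimes x$, $\Delta(y)=1\otimes y+y\otimes x$, $\varepsilon(x)=1$, $\varepsilon(y)=0$. Let $S(t_H)$ be the symmetric algebra on a copy $t_H=\{t_a : a\in H\}$ of the vector space $H$, and let $a\mapsto t^{-1}_a$ be the unique linear map from $H$ to the field of fractions $\operatorname{Frac} S(t_H)$ such that $\sum t_{a_1}t^{-1}_{a_2}=\sum t^{-1}_{a_1}t_{a_2}=\varepsilon(a)1$ for all $a\in H$, where $\Delta(a)=\sum a_1\otimes a_2$. Let $S(t_H)_\Theta\subset \operatorname{Frac} S(t_H)$ be the $k$-subalgebra generated by all $t_a$ and $t_a^{-1}$ ($a\in H$). The generic base algebra $\mathcal B_H\subset S(t_H)_\Theta$ (for the trivial two-cocycle) is the $k$-subalgebra generated by all elements $$\sigma(a,b)=\sum t_{a_1}t_{b_1}t^{-1}_{a_2b_2},\qquad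 \sigma^{-1}(a,b)=\sum t_{a_1b_1}t^{-1}_{a_2}t^{-1}_{b_2}\qquad(a,b\in H).$$ Put $$\Gamma_0=\{t_x t_{x^{n-1}}\}\cup\{t_{x^i}/(t_x)^i : 0\le i<n,\ i\ne 1\},$$ $$\Gamma_1=\{t_{x^iy^j}t_{x^l} : 0\le i,j,l<n,\ j\ne 0,\ i+j+l\equiv 0 \pmod n\},$$ and let $\Gamma_0^{-1}$ be the set of inverses of the elements of $\Gamma_0$. Then: (a) The set $\Gamma_0\cup\Gamma_1$ has exactly $n^2$ elements, and they are algebraically independent over $k$. (b) $\mathcal B_H=k[\Gamma_0,\Gamma_0^{-1},\Gamma_1]$, the $k$-subalgebra generated by $\Gamma_0\cup\Gamma_0^{-1}\cup\Gamma_1$. Moreover, there is a $\mathbb Z/n$-grading of the $k$-algebra $S(t_H)_\Theta$ such that $t_{x^iy^j}$ is homogeneous of degree $i+j \bmod n$ for all $0\le i,j<n$, and such that $\mathcal B_H$ is the subalgebra of elements of degree $0$. -/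

import Mathlib

open scoped TensorProduct

/-! ### The Taft algebra as a Hopf algebra -/

namespace Taft

/-- The two generators of the Taft algebra. -/
inductive Gen : Type
  | x
  | y

/-- The defining relations `x ^ n = 1`, `y x = q x y`, `y ^ n = 0`. -/
inductive Rel {k : Type*} [Field k] (n : ℕ) (q : k) :
    FreeAlgebra k Gen → FreeAlgebra k Gen → Prop
  | x_pow : Rel n q (FreeAlgebra.ι k Gen.x ^ n) 1
  | y_mul_x : Rel n q (FreeAlgebra.ι k Gen.y * FreeAlgebra.ι k Gen.x)
      (q • (FreeAlgebra.ι k Gen.x * FreeAlgebra.ι k Gen.y))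
  | y_pow : Rel n q (FreeAlgebra.ι k Gen.y ^ n) 0

end Taft

/-- The Taft algebra `k⟨x, y | x ^ n = 1, y x = q x y, y ^ n = 0⟩`, where `n ≥ 2` and `q` is a
primitive `n`-th root of unity. The two proofs are carried as parameters because the coproduct is
well defined only under these assumptions. -/
def TaftAlgebra {k : Type*} [Field k] {n : ℕ} {q : k} (_hn : 2 ≤ n)
    (_hq : IsPrimitiveRoot q n) : Type _ :=
  RingQuot (Taft.Rel n q)

namespace Taft

section Construction

variable {k : Type*} [Field k] {n : ℕ} {q : k} (hn : 2 ≤ n) (hq : IsPrimitiveRoot q n)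

noncomputable instance instRing : Ring (TaftAlgebra hn hq) :=
  inferInstanceAs (Ring (RingQuot (Rel n q)))

noncomputable instance instAlgebra : Algebra k (TaftAlgebra hn hq) :=
  inferInstanceAs (Algebra k (RingQuot (Rel n q)))

/-- The generator `x` of the Taft algebra. -/
noncomputable def x : TaftAlgebra hn hq := RingQuot.mkAlgHom k (Rel n q) (FreeAlgebra.ι k Gen.x)

/-- The generator `y` of the Taft algebra. -/
noncomputable def y : TaftAlgebra hn hq := RingQuot.mkAlgHom k (Rel n q) (FreeAlgebra.ι k Gen.y)

theorem x_pow : x hn hq ^ n = 1 := by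
  have h := RingQuot.mkAlgHom_rel k (Rel.x_pow (n := n) (q := q))
  rw [map_pow, map_one] at h
  exact h

theorem y_mul_x : y hn hq * x hn hq = q • (x hn hq * y hn hq) := by
  have h := RingQuot.mkAlgHom_rel k (Rel.y_mul_x (n := n) (q := q))
  rw [map_smul, map_mul, map_mul] at h
  exact h

theorem y_pow : y hn hq ^ n = 0 := by
  have h := RingQuot.mkAlgHom_rel k (Rel.y_pow (n := n) (q := q))
  rw [map_pow, map_zero] at h
  exact h

/-- The images of the two generators under an algebra map out of the free algebra. -/
def genMap {A : Type*} (a b : A) : Gen → A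
  | Gen.x => a
  | Gen.y => b

/-- The universal property of the presentation. -/
noncomputable def lift {A : Type*} [Ring A] [Algebra k A] (a b : A) (ha : a ^ n = 1)
    (hab : b * a = q • (a * b)) (hb : b ^ n = 0) : TaftAlgebra hn hq →ₐ[k] A :=
  RingQuot.liftAlgHom k ⟨FreeAlgebra.lift k (genMap a b), by
    intro u v h
    cases h with
    | x_pow => simp [genMap, ha]
    | y_mul_x => simp [genMap, hab]
    | y_pow => simp [genMap, hb]⟩

theorem lift_x {A : Type*} [Ring A] [Algebra k A] (a b : A) (ha : a ^ n = 1)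
    (hab : b * a = q • (a * b)) (hb : b ^ n = 0) : lift hn hq a b ha hab hb (x hn hq) = a := by
  refine (RingQuot.liftAlgHom_mkAlgHom_apply k _ _ _).trans ?_
  simp [genMap]

theorem lift_y {A : Type*} [Ring A] [Algebra k A] (a b : A) (ha : a ^ n = 1)
    (hab : b * a = q • (a * b)) (hb : b ^ n = 0) : lift hn hq a b ha hab hb (y hn hq) = b := by
  refine (RingQuot.liftAlgHom_mkAlgHom_apply k _ _ _).trans ?_
  simp [genMap]

theorem induction {P : TaftAlgebra hn hq → Prop}
    (halg : ∀ r : k, P (algebraMap k _ r)) (hx : P (x hn hq)) (hy : P (y hn hq))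
    (hadd : ∀ a b, P a → P b → P (a + b)) (hmul : ∀ a b, P a → P b → P (a * b))
    (a : TaftAlgebra hn hq) : P a := by
  obtain ⟨a, rfl⟩ := RingQuot.mkAlgHom_surjective k (Rel n q) a
  induction a using FreeAlgebra.induction with
  | grade0 r =>
    rw [AlgHom.commutes]
    exact halg r
  | grade1 g =>
    cases g with
    | x => exact hx
    | y => exact hy
  | mul a b ha hb =>
    rw [map_mul]
    exact hmul _ _ ha hb
  | add a b ha hb =>
    rw [map_add]
    exact hadd _ _ ha hb

theorem algHom_ext {A : Type*} [Ring A] [Algebra k A] {f g : TaftAlgebra hn hq →ₐ[k] A}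
    (hx : f (x hn hq) = g (x hn hq)) (hy : f (y hn hq) = g (y hn hq)) : f = g := by
  refine AlgHom.ext fun a => ?_
  refine induction hn hq (P := fun a => f a = g a) ?_ hx hy ?_ ?_ a
  · intro r
    rw [AlgHom.commutes, AlgHom.commutes]
  · intro a b ha hb
    rw [map_add, map_add, ha, hb]
  · intro a b ha hb
    rw [map_mul, map_mul, ha, hb]

end Construction

section QBinomial

/-- Gaussian binomial coefficients, through their Pascal recursion. -/
def qChoose {k : Type*} [Field k] (q : k) : ℕ → ℕ → k
  | _, 0 => 1
  | 0, _ + 1 => 0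
  | m + 1, r + 1 => qChoose q m r + q ^ (r + 1) * qChoose q m (r + 1)

variable {k : Type*} [Field k]

theorem qChoose_zero_right (q : k) (m : ℕ) : qChoose q m 0 = 1 := by
  cases m <;> rfl

theorem qChoose_of_lt (q : k) : ∀ m r : ℕ, m < r → qChoose q m r = 0
  | _, 0, h => absurd h (Nat.not_lt_zero _)
  | 0, _ + 1, _ => rfl
  | m + 1, r + 1, h => by
    simp only [qChoose]
    rw [qChoose_of_lt q m r (by omega), qChoose_of_lt q m (r + 1) (by omega)]
    ring

theorem qChoose_self (q : k) : ∀ m : ℕ, qChoose q m m = 1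
  | 0 => rfl
  | m + 1 => by
    simp only [qChoose]
    rw [qChoose_self q m, qChoose_of_lt q m (m + 1) (by omega)]
    ring

theorem qChoose_succ_mul (q : k) : ∀ m r : ℕ,
    (1 - q ^ (r + 1)) * qChoose q (m + 1) (r + 1) = (1 - q ^ (m + 1)) * qChoose q m r
  | 0, 0 => by simp [qChoose]
  | 0, r + 1 => by simp [qChoose]
  | m + 1, 0 => by
    have h := qChoose_succ_mul q m 0
    have e : qChoose q (m + 2) 1 = qChoose q (m + 1) 0 + q ^ 1 * qChoose q (m + 1) 1 := rfl
    rw [qChoose_zero_right] at h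
    simp only [Nat.zero_add] at h ⊢
    rw [e, qChoose_zero_right]
    linear_combination q * h
  | m + 1, r + 1 => by
    have h1 := qChoose_succ_mul q m (r + 1)
    have h2 := qChoose_succ_mul q m r
    have e1 : qChoose q (m + 2) (r + 2) =
      qChoose q (m + 1) (r + 1) + q ^ (r + 2) * qChoose q (m + 1) (r + 2) := rfl
    have e2 : qChoose q (m + 1) (r + 1) =
      qChoose q m r + q ^ (r + 1) * qChoose q m (r + 1) := rfl
    rw [e1]
    linear_combination q ^ (r + 2) * h1 + q * h2 - q * (1 - q ^ (m + 1)) * e2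

theorem qChoose_eq_zero {q : k} {n : ℕ} (hq : IsPrimitiveRoot q n) (r : ℕ) (h0 : 0 < r)
    (hr : r < n) : qChoose q n r = 0 := by
  obtain ⟨m, rfl⟩ : ∃ m, n = m + 1 := ⟨n - 1, by omega⟩
  obtain ⟨s, rfl⟩ : ∃ s, r = s + 1 := ⟨r - 1, by omega⟩
  have h := qChoose_succ_mul q m s
  rw [hq.pow_eq_one, sub_self, zero_mul] at h
  refine (mul_eq_zero.mp h).resolve_left ?_
  exact sub_ne_zero.mpr (hq.pow_ne_one_of_pos_of_lt (by omega) hr).symm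

theorem mul_pow_comm {A : Type*} [Ring A] [Algebra k A] {q : k} {a b : A}
    (hab : a * b = q • (b * a)) (r : ℕ) : a * b ^ r = q ^ r • (b ^ r * a) := by
  induction r with
  | zero => simp
  | succ r ih =>
    rw [pow_succ, ← mul_assoc, ih, smul_mul_assoc, mul_assoc, hab, mul_smul_comm, smul_smul,
      ← pow_succ, mul_assoc]

/-- The `q`-binomial formula. -/
theorem add_pow_eq {A : Type*} [Ring A] [Algebra k A] {q : k} {a b : A}
    (hab : a * b = q • (b * a)) (m : ℕ) :
    (b + a) ^ m = ∑ r ∈ Finset.range (m + 1), qChoose q m r • (b ^ r * a ^ (m - r)) := by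
  induction m with
  | zero => simp [qChoose]
  | succ m ih =>
    have h1 : ∀ r ∈ Finset.range (m + 1), (b + a) * (qChoose q m r • (b ^ r * a ^ (m - r))) =
        qChoose q m r • (b ^ (r + 1) * a ^ (m - r)) +
          (q ^ r * qChoose q m r) • (b ^ r * a ^ (m + 1 - r)) := by
      intro r hr
      have hr' : m + 1 - r = (m - r) + 1 := by
        have := Finset.mem_range.mp hr
        omega
      rw [add_mul, mul_smul_comm, mul_smul_comm, ← mul_assoc, ← pow_succ', ← mul_assoc,
        mul_pow_comm hab, smul_mul_assoc, smul_smul, mul_assoc, ← pow_succ', hr',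
        mul_comm (q ^ r)]
    rw [pow_succ', ih, Finset.mul_sum, Finset.sum_congr rfl h1, Finset.sum_add_distrib,
      Finset.sum_range_succ' _ (m + 1)]
    have h2 : ∀ r ∈ Finset.range (m + 1),
        qChoose q (m + 1) (r + 1) • (b ^ (r + 1) * a ^ (m + 1 - (r + 1))) =
          qChoose q m r • (b ^ (r + 1) * a ^ (m - r)) +
          (q ^ (r + 1) * qChoose q m (r + 1)) • (b ^ (r + 1) * a ^ (m + 1 - (r + 1))) := by
      intro r _
      rw [Nat.add_sub_add_right, ← add_smul]
      rfl
    rw [Finset.sum_congr rfl h2, Finset.sum_add_distrib, add_assoc]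
    congr 1
    rw [Finset.sum_range_succ' _ m, Finset.sum_range_succ _ m,
      qChoose_of_lt q m (m + 1) (by omega)]
    simp [qChoose_zero_right]

theorem add_pow_eq_zero {A : Type*} [Ring A] [Algebra k A] {q : k} {n : ℕ}
    (hq : IsPrimitiveRoot q n) {a b : A}
    (hab : a * b = q • (b * a)) (ha : a ^ n = 0) (hb : b ^ n = 0) : (b + a) ^ n = 0 := by
  rw [add_pow_eq hab]
  refine Finset.sum_eq_zero fun r hr => ?_
  rcases Nat.eq_zero_or_pos r with rfl | h0
  · simp [ha]
  · rcases Nat.lt_or_ge r n with hlt | hge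
    · rw [qChoose_eq_zero hq r h0 hlt, zero_smul]
    · have : r = n := by
        have := Finset.mem_range.mp hr
        omega
      simp [this, hb]

end QBinomial

section Hopf

variable {k : Type*} [Field k] {n : ℕ} {q : k} (hn : 2 ≤ n) (hq : IsPrimitiveRoot q n)

/-- The coproduct: `Δ x = x ⊗ x` and `Δ y = 1 ⊗ y + y ⊗ x`. -/
noncomputable def comulHom :
    TaftAlgebra hn hq →ₐ[k] TaftAlgebra hn hq ⊗[k] TaftAlgebra hn hq :=
  lift hn hq (x hn hq ⊗ₜ x hn hq) (1 ⊗ₜ y hn hq + y hn hq ⊗ₜ x hn hq)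
    (by rw [Algebra.TensorProduct.tmul_pow, x_pow]; rfl)
    (by
      rw [add_mul, mul_add, smul_add]
      simp only [Algebra.TensorProduct.tmul_mul_tmul, y_mul_x, one_mul, mul_one,
        TensorProduct.tmul_smul, TensorProduct.smul_tmul'])
    (by
      rw [add_comm]
      refine add_pow_eq_zero hq ?_ ?_ ?_
      · simp only [Algebra.TensorProduct.tmul_mul_tmul, y_mul_x, one_mul, mul_one,
          TensorProduct.tmul_smul]
      · rw [Algebra.TensorProduct.tmul_pow, y_pow, TensorProduct.tmul_zero]
      · rw [Algebra.TensorProduct.tmul_pow, y_pow, TensorProduct.zero_tmul])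

/-- The counit: `ε x = 1` and `ε y = 0`. -/
noncomputable def counitHom : TaftAlgebra hn hq →ₐ[k] k :=
  lift hn hq 1 0 (one_pow n) (by simp) (zero_pow (by omega))

theorem comulHom_x : comulHom hn hq (x hn hq) = x hn hq ⊗ₜ x hn hq := lift_x ..

theorem comulHom_y :
    comulHom hn hq (y hn hq) = 1 ⊗ₜ y hn hq + y hn hq ⊗ₜ x hn hq := lift_y ..

theorem counitHom_x : counitHom hn hq (x hn hq) = 1 := lift_x ..

theorem counitHom_y : counitHom hn hq (y hn hq) = 0 := lift_y ..

noncomputable instance instBialgebra : Bialgebra k (TaftAlgebra hn hq) :=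
  Bialgebra.ofAlgHom (comulHom hn hq) (counitHom hn hq)
    (by
      apply algHom_ext
      · simp [comulHom_x]
      · simp [comulHom_y, comulHom_x, TensorProduct.add_tmul, TensorProduct.tmul_add,
          Algebra.TensorProduct.one_def, add_assoc])
    (by
      apply algHom_ext
      · simp [comulHom_x, counitHom_x]
      · simp [comulHom_y, counitHom_y])
    (by
      apply algHom_ext
      · simp [comulHom_x, counitHom_x]
      · simp [comulHom_y, counitHom_y, counitHom_x])

theorem comul_x : Coalgebra.comul (R := k) (x hn hq) = x hn hq ⊗ₜ x hn hq := comulHom_x hn hq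

theorem comul_y :
    Coalgebra.comul (R := k) (y hn hq) = 1 ⊗ₜ y hn hq + y hn hq ⊗ₜ x hn hq := comulHom_y hn hq

theorem counit_x : Coalgebra.counit (R := k) (x hn hq) = 1 := counitHom_x hn hq

theorem counit_y : Coalgebra.counit (R := k) (y hn hq) = 0 := counitHom_y hn hq

theorem x_mul_x_pow : x hn hq * x hn hq ^ (n - 1) = 1 := by
  rw [← pow_succ', Nat.sub_add_cancel (by omega), x_pow]

theorem x_pow_mul_x : x hn hq ^ (n - 1) * x hn hq = 1 := by
  rw [← pow_succ, Nat.sub_add_cancel (by omega), x_pow]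

theorem x_inv_mul_y :
    x hn hq ^ (n - 1) * y hn hq = q • (y hn hq * x hn hq ^ (n - 1)) := by
  calc x hn hq ^ (n - 1) * y hn hq
      = x hn hq ^ (n - 1) * ((y hn hq * x hn hq) * x hn hq ^ (n - 1)) := by
        rw [mul_assoc (y hn hq), x_mul_x_pow, mul_one]
    _ = q • ((x hn hq ^ (n - 1) * x hn hq) * (y hn hq * x hn hq ^ (n - 1))) := by
        rw [y_mul_x, smul_mul_assoc, mul_smul_comm]
        simp only [mul_assoc]
    _ = _ := by rw [x_pow_mul_x, one_mul]

theorem y_mul_x_inv_pow (m : ℕ) : ∃ c : k,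
    (-(y hn hq * x hn hq ^ (n - 1))) ^ m = c • (y hn hq ^ m * (x hn hq ^ (n - 1)) ^ m) := by
  induction m with
  | zero => exact ⟨1, by simp⟩
  | succ m ih =>
    obtain ⟨c, hc⟩ := ih
    have h := mul_pow_comm (x_inv_mul_y hn hq) m
    refine ⟨-(c * q ^ m), ?_⟩
    rw [pow_succ', hc, neg_mul, mul_smul_comm, mul_assoc, ← mul_assoc (x hn hq ^ (n - 1)), h,
      smul_mul_assoc, mul_smul_comm, smul_smul, ← neg_smul, mul_assoc (y hn hq ^ m), ← pow_succ',
      ← mul_assoc, ← pow_succ']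

/-- The antipode, as an algebra map to the opposite algebra: `S x = x⁻¹` and `S y = - y x⁻¹`. -/
noncomputable def antipodeHom : TaftAlgebra hn hq →ₐ[k] (TaftAlgebra hn hq)ᵐᵒᵖ :=
  lift hn hq (MulOpposite.op (x hn hq ^ (n - 1)))
    (MulOpposite.op (-(y hn hq * x hn hq ^ (n - 1))))
    (by rw [← MulOpposite.op_pow, ← pow_mul, mul_comm, pow_mul, x_pow, one_pow]; rfl)
    (by
      rw [← MulOpposite.op_mul, ← MulOpposite.op_mul, ← MulOpposite.op_smul, mul_neg, neg_mul,
        ← mul_assoc, x_inv_mul_y, smul_mul_assoc, smul_neg])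
    (by
      obtain ⟨c, hc⟩ := y_mul_x_inv_pow hn hq n
      rw [← MulOpposite.op_pow, hc, y_pow, zero_mul, smul_zero]; rfl)

/-- The antipode as a linear map. -/
noncomputable def antipodeMap : TaftAlgebra hn hq →ₗ[k] TaftAlgebra hn hq :=
  (MulOpposite.opLinearEquiv k).symm.toLinearMap ∘ₗ (antipodeHom hn hq).toLinearMap

theorem antipodeMap_mul (a b : TaftAlgebra hn hq) :
    antipodeMap hn hq (a * b) = antipodeMap hn hq b * antipodeMap hn hq a := by
  simp [antipodeMap]

theorem antipodeMap_algebraMap (r : k) :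
    antipodeMap hn hq (algebraMap k _ r) = algebraMap k _ r := by
  simp [antipodeMap]

theorem antipodeMap_one : antipodeMap hn hq 1 = 1 := by
  simp [antipodeMap]

theorem antipodeMap_x : antipodeMap hn hq (x hn hq) = x hn hq ^ (n - 1) := by
  simp [antipodeMap, antipodeHom, lift_x]

theorem antipodeMap_y : antipodeMap hn hq (y hn hq) = -(y hn hq * x hn hq ^ (n - 1)) := by
  simp [antipodeMap, antipodeHom, lift_y]

theorem antipode_left_mul (z w : TaftAlgebra hn hq ⊗[k] TaftAlgebra hn hq) (c : k)
    (hz : LinearMap.mul' k _ (TensorProduct.map (antipodeMap hn hq) LinearMap.id z) =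
      algebraMap k _ c) :
    LinearMap.mul' k _ (TensorProduct.map (antipodeMap hn hq) LinearMap.id (z * w)) =
      algebraMap k _ c *
        LinearMap.mul' k _ (TensorProduct.map (antipodeMap hn hq) LinearMap.id w) := by
  induction w with
  | zero => simp
  | add w₁ w₂ h₁ h₂ => rw [mul_add, map_add, map_add, map_add, map_add, mul_add, h₁, h₂]
  | tmul a b =>
    have key : ∀ z : TaftAlgebra hn hq ⊗[k] TaftAlgebra hn hq,
        LinearMap.mul' k _ (TensorProduct.map (antipodeMap hn hq) LinearMap.id (z * a ⊗ₜ b)) =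
        antipodeMap hn hq a *
          LinearMap.mul' k _ (TensorProduct.map (antipodeMap hn hq) LinearMap.id z) * b := by
      intro z
      induction z with
      | zero => simp
      | add z₁ z₂ h₁ h₂ => rw [add_mul, map_add, map_add, map_add, map_add, mul_add, add_mul, h₁, h₂]
      | tmul c d =>
        simp [antipodeMap_mul, mul_assoc]
    rw [key, hz, ← Algebra.commutes, TensorProduct.map_tmul, LinearMap.mul'_apply, mul_assoc]
    rfl

theorem antipode_right_mul (z w : TaftAlgebra hn hq ⊗[k] TaftAlgebra hn hq) (c : k)
    (hw : LinearMap.mul' k _ (TensorProduct.map LinearMap.id (antipodeMap hn hq) w) =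
      algebraMap k _ c) :
    LinearMap.mul' k _ (TensorProduct.map LinearMap.id (antipodeMap hn hq) (z * w)) =
      LinearMap.mul' k _ (TensorProduct.map LinearMap.id (antipodeMap hn hq) z) *
        algebraMap k _ c := by
  induction z with
  | zero => simp
  | add w₁ w₂ h₁ h₂ => rw [add_mul, map_add, map_add, map_add, map_add, add_mul, h₁, h₂]
  | tmul a b =>
    have key : ∀ w : TaftAlgebra hn hq ⊗[k] TaftAlgebra hn hq,
        LinearMap.mul' k _ (TensorProduct.map LinearMap.id (antipodeMap hn hq) (a ⊗ₜ b * w)) =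
        a * LinearMap.mul' k _ (TensorProduct.map LinearMap.id (antipodeMap hn hq) w) *
          antipodeMap hn hq b := by
      intro z
      induction z with
      | zero => simp
      | add z₁ z₂ h₁ h₂ => rw [mul_add, map_add, map_add, map_add, map_add, mul_add, add_mul, h₁, h₂]
      | tmul c d =>
        simp [antipodeMap_mul, mul_assoc]
    rw [key, hw, mul_assoc, Algebra.commutes, TensorProduct.map_tmul, LinearMap.mul'_apply,
      mul_assoc]
    rfl

theorem antipode_left (a : TaftAlgebra hn hq) :
    LinearMap.mul' k _ (TensorProduct.map (antipodeMap hn hq) LinearMap.id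
      (Coalgebra.comul (R := k) a)) = algebraMap k _ (Coalgebra.counit (R := k) a) := by
  refine induction hn hq (P := fun a => LinearMap.mul' k _
    (TensorProduct.map (antipodeMap hn hq) LinearMap.id
      (Coalgebra.comul (R := k) a)) = algebraMap k _ (Coalgebra.counit (R := k) a)) ?_ ?_ ?_ ?_ ?_ a
  · intro r
    rw [Bialgebra.comul_algebraMap, Bialgebra.counit_algebraMap,
      Algebra.TensorProduct.algebraMap_apply, TensorProduct.map_tmul, LinearMap.mul'_apply,
      antipodeMap_algebraMap]
    simp
  · rw [comul_x, counit_x, TensorProduct.map_tmul, LinearMap.mul'_apply, antipodeMap_x]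
    simp [x_pow_mul_x]
  · rw [comul_y, counit_y, map_add, map_add, TensorProduct.map_tmul, TensorProduct.map_tmul,
      LinearMap.mul'_apply, LinearMap.mul'_apply, antipodeMap_y, antipodeMap_one]
    simp [mul_assoc, x_pow_mul_x]
  · intro a b ha hb
    simp only [map_add, ha, hb]
  · intro a b ha hb
    rw [Bialgebra.comul_mul, Bialgebra.counit_mul, antipode_left_mul hn hq _ _ _ ha, hb, map_mul]

theorem antipode_right (a : TaftAlgebra hn hq) :
    LinearMap.mul' k _ (TensorProduct.map LinearMap.id (antipodeMap hn hq)
      (Coalgebra.comul (R := k) a)) = algebraMap k _ (Coalgebra.counit (R := k) a) := by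
  refine induction hn hq (P := fun a => LinearMap.mul' k _
    (TensorProduct.map LinearMap.id (antipodeMap hn hq)
      (Coalgebra.comul (R := k) a)) = algebraMap k _ (Coalgebra.counit (R := k) a)) ?_ ?_ ?_ ?_ ?_ a
  · intro r
    rw [Bialgebra.comul_algebraMap, Bialgebra.counit_algebraMap,
      Algebra.TensorProduct.algebraMap_apply, TensorProduct.map_tmul, LinearMap.mul'_apply,
      antipodeMap_one]
    simp
  · rw [comul_x, counit_x, TensorProduct.map_tmul, LinearMap.mul'_apply, antipodeMap_x]
    simp [x_mul_x_pow]
  · rw [comul_y, counit_y, map_add, map_add, TensorProduct.map_tmul, TensorProduct.map_tmul,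
      LinearMap.mul'_apply, LinearMap.mul'_apply, antipodeMap_y, antipodeMap_x]
    simp
  · intro a b ha hb
    simp only [map_add, ha, hb]
  · intro a b ha hb
    rw [Bialgebra.comul_mul, Bialgebra.counit_mul, antipode_right_mul hn hq _ _ _ hb, ha, map_mul]

noncomputable instance instHopfAlgebra : HopfAlgebra k (TaftAlgebra hn hq) where
  antipode := antipodeMap hn hq
  mul_antipode_rTensor_comul := LinearMap.ext (antipode_left hn hq)
  mul_antipode_lTensor_comul := LinearMap.ext (antipode_right hn hq)

end Hopf

end Taft

/-! ### The generic base algebra of a Hopf algebra (for the trivial two-cocycle) -/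

namespace GenericBase

section General

variable (k : Type*) [Field k] (H : Type*) [Ring H] [HopfAlgebra k H]

/-- The field of fractions of the symmetric algebra on (a copy of) the vector space `H`. -/
abbrev FracSym : Type _ := FractionRing (SymmetricAlgebra k H)

/-- The linear map `a ↦ t_a` from `H` to the field of fractions of the symmetric algebra. -/
noncomputable def t : H →ₗ[k] FracSym k H :=
  (Algebra.linearMap (SymmetricAlgebra k H) (FracSym k H)).restrictScalars k ∘ₗ
    SymmetricAlgebra.ι k H

/-- The linear map `a ↦ t⁻¹_a`: the inverse of `t` for the convolution product on linear maps
from `H` to the field of fractions, that is, the unique linear map with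
`∑ t_{a₁} t⁻¹_{a₂} = ∑ t⁻¹_{a₁} t_{a₂} = ε(a)`. -/
noncomputable def tInv : H →ₗ[k] FracSym k H :=
  (Ring.inverse (WithConv.toConv (t k H))).ofConv

/-- The localization `S(t_H)_Θ`: the subalgebra of the field of fractions generated by all
`t_a` and `t⁻¹_a`. -/
noncomputable def localization : Subalgebra k (FracSym k H) :=
  Algebra.adjoin k (Set.range (t k H) ∪ Set.range (tInv k H))

/-- The element `t_a` of `S(t_H)_Θ`. -/
noncomputable def tLoc (a : H) : localization k H :=
  ⟨t k H a, Algebra.subset_adjoin (Or.inl ⟨a, rfl⟩)⟩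

/-- The generic cocycle `σ(a, b) = t_{a₁} t_{b₁} t⁻¹_{a₂ b₂}`, as a linear map on `H ⊗ H`
(written as a convolution product over the tensor product coalgebra). -/
noncomputable def sigma : H ⊗[k] H →ₗ[k] FracSym k H :=
  (WithConv.toConv (LinearMap.mul' k (FracSym k H) ∘ₗ TensorProduct.map (t k H) (t k H)) *
    WithConv.toConv (tInv k H ∘ₗ LinearMap.mul' k H)).ofConv

/-- The inverse of the generic cocycle, `σ⁻¹(a, b) = t_{a₁ b₁} t⁻¹_{a₂} t⁻¹_{b₂}`. -/
noncomputable def sigmaInv : H ⊗[k] H →ₗ[k] FracSym k H :=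
  (WithConv.toConv (t k H ∘ₗ LinearMap.mul' k H) *
    WithConv.toConv
      (LinearMap.mul' k (FracSym k H) ∘ₗ TensorProduct.map (tInv k H) (tInv k H))).ofConv

/-- The generic base algebra: the subalgebra generated by the values of the generic cocycle and
of its inverse. -/
noncomputable def baseAlgebra : Subalgebra k (FracSym k H) :=
  Algebra.adjoin k
    (Set.range (fun p : H × H => sigma k H (p.1 ⊗ₜ p.2)) ∪
      Set.range (fun p : H × H => sigmaInv k H (p.1 ⊗ₜ p.2)))

end General

end GenericBase

/-! ### The generators in the case of the Taft algebra -/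

namespace Taft

section Generators

open GenericBase

variable {k : Type*} [Field k] {n : ℕ} {q : k} (hn : 2 ≤ n) (hq : IsPrimitiveRoot q n)

/-- `Γ₀` consists of `t_x t_{x^(n-1)}` and of `t_{x^i} / (t_x)^i` for `0 ≤ i < n`, `i ≠ 1`. -/
def Gamma0 : Set (FracSym k (TaftAlgebra hn hq)) :=
  {t k _ (x hn hq) * t k _ (x hn hq ^ (n - 1))} ∪
    {g | ∃ i : ℕ, i < n ∧ i ≠ 1 ∧ g = t k _ (x hn hq ^ i) / t k _ (x hn hq) ^ i}

/-- The set of inverses of the elements of `Γ₀`. -/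
def Gamma0Inv : Set (FracSym k (TaftAlgebra hn hq)) :=
  {g | ∃ f ∈ Gamma0 hn hq, g = f⁻¹}

/-- `Γ₁` consists of the `t_{x^i y^j} t_{x^l}` with `0 ≤ i, j, l < n`, `j ≠ 0` and
`i + j + l ≡ 0` modulo `n`. -/
def Gamma1 : Set (FracSym k (TaftAlgebra hn hq)) :=
  {g | ∃ i j l : ℕ, i < n ∧ j < n ∧ l < n ∧ j ≠ 0 ∧ i + j + l ≡ 0 [MOD n] ∧
    g = t k _ (x hn hq ^ i * y hn hq ^ j) * t k _ (x hn hq ^ l)}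

end Generators

end Taft

/-! Write `u = t_x`. As `Δ(x^i y^j)` is a `q`-binomial sum of terms `x^i y^r ⊗ x^(i+r) y^(j-r)`,
giving `t_{x^i y^j}` weight `i + j` modulo `n` forces weight `-i` on `t⁻¹_{x^i y^j}`, and then all
values of `σ` and `σ⁻¹` have weight zero. The proof therefore works with the normalised elements
`t_{x^i y^j} / u^(i+j)` and `t⁻¹_{x^i y^j} u^i`.

Let `B = k[Γ₀, Γ₀⁻¹, Γ₁]`. Since `u^n` is a quotient of two elements of `Γ₀`, `B` contains `u^n` and
its inverse, hence all normalised elements (`tMon_div_pow_mem_gammaAlgebra`), hence the base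
algebra. Conversely, `σ` and `σ⁻¹` at powers of `x` give `Γ₀`, its inverses and `u^n`. The elements
with `j > 0` follow by induction on `j` (`tMon_div_pow_mem_baseAlgebra`): in `σ⁻¹(x^a y^j, x) -
σ⁻¹(x, x^a y^j)` the only new term is a multiple of `t_{x^(a+1) y^j}` with factor `q^j - 1 ≠ 0`.

The piece of degree `m` is `u^m B`. These pieces span because they multiply correctly and contain
the generators. They are independent because the automorphism `scaleFrac`, which scales `t_{x^i
y^j}` by `q^(i+j)`, fixes `B` and acts on `u^m B` by `q^m`.

For algebraic independence, the field of fractions has transcendence degree `n^2` and is algebraic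
over the algebra generated by the `n^2` elements of `Γ₀ ∪ Γ₁`, so none of these is redundant. -/

namespace Taft

/-! ### The monomial basis of the Taft algebra -/

section Basis

variable {k : Type*} [Field k] {n : ℕ} {q : k} (hn : 2 ≤ n) (hq : IsPrimitiveRoot q n)

theorem y_pow_mul_x_pow (j i : ℕ) :
    y hn hq ^ j * x hn hq ^ i = q ^ (i * j) • (x hn hq ^ i * y hn hq ^ j) := by
  induction j with
  | zero => simp
  | succ j ih =>
    rw [pow_succ', mul_assoc, ih, mul_smul_comm, ← mul_assoc,
      mul_pow_comm (y_mul_x hn hq) i, smul_mul_assoc, smul_smul, mul_assoc, ← pow_add,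
      Nat.mul_succ]

theorem monomial_mul (a b c d : ℕ) :
    x hn hq ^ a * y hn hq ^ b * (x hn hq ^ c * y hn hq ^ d) =
      q ^ (c * b) • (x hn hq ^ (a + c) * y hn hq ^ (b + d)) := by
  rw [mul_assoc, ← mul_assoc (y hn hq ^ b), y_pow_mul_x_pow, smul_mul_assoc, mul_smul_comm,
    pow_add, pow_add]
  simp only [mul_assoc]

theorem x_pow_mod (i : ℕ) : x hn hq ^ (i % n) = x hn hq ^ i := by
  conv_rhs => rw [← Nat.mod_add_div i n, pow_add, pow_mul, x_pow, one_pow, mul_one]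

theorem y_pow_of_le {j : ℕ} (h : n ≤ j) : y hn hq ^ j = 0 := by
  rw [← Nat.add_sub_cancel' h, pow_add, y_pow, zero_mul]

/-- The two summands of `Δ y` satisfy `(1 ⊗ y)(y ⊗ x) = q (y ⊗ x)(1 ⊗ y)`, so the `q`-binomial
formula applies. -/
theorem comul_monomial (i j : ℕ) :
    Coalgebra.comul (R := k) (x hn hq ^ i * y hn hq ^ j) =
      ∑ r ∈ Finset.range (j + 1), qChoose q j r •
        ((x hn hq ^ i * y hn hq ^ r) ⊗ₜ[k] (x hn hq ^ (i + r) * y hn hq ^ (j - r))) := by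
  rw [Bialgebra.comul_mul, Bialgebra.comul_pow, Bialgebra.comul_pow, comul_x, comul_y,
    add_comm, add_pow_eq (q := q), Finset.mul_sum]
  · refine Finset.sum_congr rfl fun r _ => ?_
    rw [mul_smul_comm]
    simp only [Algebra.TensorProduct.tmul_pow, Algebra.TensorProduct.tmul_mul_tmul, one_pow,
      mul_one, pow_add, mul_assoc]
  · simp only [Algebra.TensorProduct.tmul_mul_tmul, y_mul_x, one_mul, mul_one,
      TensorProduct.tmul_smul]

theorem counit_monomial (i j : ℕ) :
    Coalgebra.counit (R := k) (x hn hq ^ i * y hn hq ^ j) = if j = 0 then 1 else 0 := by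
  rw [Bialgebra.counit_mul, Bialgebra.counit_pow, Bialgebra.counit_pow, counit_x, counit_y]
  simp [zero_pow_eq]

/-- The action of `x` in the regular representation, on functions of the two exponents. -/
def regX (k : Type*) [Field k] (n : ℕ) : Module.End k (ZMod n → ℕ → k) where
  toFun f i j := f (i - 1) j
  map_add' _ _ := rfl
  map_smul' _ _ := rfl

/-- The action of `y` in the regular representation, on functions of the two exponents. -/
def regY {k : Type*} [Field k] (n : ℕ) (q : k) : Module.End k (ZMod n → ℕ → k) where
  toFun f i j := if 0 < j ∧ j < n then q ^ i.val * f i (j - 1) else 0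
  map_add' f g := by
    ext i j
    by_cases h : 0 < j ∧ j < n <;> simp [h, mul_add]
  map_smul' c f := by
    ext i j
    by_cases h : 0 < j ∧ j < n <;> simp [h, mul_left_comm]

theorem regX_pow_apply (m : ℕ) (f : ZMod n → ℕ → k) (i : ZMod n) (j : ℕ) :
    (regX k n ^ m) f i j = f (i - m) j := by
  induction m generalizing i with
  | zero => simp
  | succ m ih =>
    rw [pow_succ', Module.End.mul_apply]
    change (regX k n ^ m) f (i - 1) j = _
    rw [ih]
    push_cast
    congr 1
    ring

/-- Only positive powers obey this formula: they vanish at `j ≥ n`, whereas the zeroth power is the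
identity there too. -/
theorem regY_pow_apply (m : ℕ) (f : ZMod n → ℕ → k) (i : ZMod n) (j : ℕ) :
    (regY n q ^ (m + 1)) f i j =
      if m < j ∧ j < n then q ^ (i.val * (m + 1)) * f i (j - (m + 1)) else 0 := by
  induction m generalizing j with
  | zero => simp [regY]
  | succ m ih =>
    rw [pow_succ', Module.End.mul_apply]
    change (if 0 < j ∧ j < n then q ^ i.val * (regY n q ^ (m + 1)) f i (j - 1) else 0) = _
    rw [ih]
    by_cases h : m + 1 < j ∧ j < n
    · rw [if_pos (by omega), if_pos (by omega), if_pos h, ← mul_assoc, ← pow_add,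
        show j - 1 - (m + 1) = j - (m + 1 + 1) by omega]
      congr 2
      ring
    · rw [if_neg h]
      split_ifs
      · omega
      · simp
      · rfl

/-- The regular representation of the Taft algebra. -/
noncomputable def regRep : TaftAlgebra hn hq →ₐ[k] Module.End k (ZMod n → ℕ → k) :=
  lift hn hq (regX k n) (regY n q)
    (by
      refine LinearMap.ext fun f => funext fun i => funext fun j => ?_
      rw [regX_pow_apply]
      simp)
    (by
      have : NeZero n := ⟨by omega⟩
      have : Fact (1 < n) := ⟨by omega⟩
      refine LinearMap.ext fun f => funext fun i => funext fun j => ?_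
      -- Passing from `n - 1` to `0` makes `val` drop by `n - 1` instead of rising by `1`; this is
      -- harmless since `q` has order `n`.
      have hpow : q ^ i.val = q * q ^ (i - 1).val := by
        rw [← pow_succ', ← pow_mod_orderOf q ((i - 1).val + 1), ← hq.eq_orderOf,
          ← pow_mod_orderOf q i.val, ← hq.eq_orderOf]
        congr 1
        have h : i = (((i - 1).val + 1 : ℕ) : ZMod n) := by simp
        conv_lhs => rw [h, ZMod.val_natCast, Nat.mod_mod]
      change (if 0 < j ∧ j < n then q ^ i.val * f (i - 1) (j - 1) else 0) =
        q * (if 0 < j ∧ j < n then q ^ (i - 1).val * f (i - 1) (j - 1) else 0)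
      rw [hpow]
      split_ifs <;> ring)
    (by
      obtain ⟨m, rfl⟩ : ∃ m, n = m + 1 := ⟨n - 1, by omega⟩
      refine LinearMap.ext fun f => funext fun i => funext fun j => ?_
      rw [regY_pow_apply, if_neg (by omega)]
      rfl)

/-- The indicator function of `(0, 0)` plays the role of `1`; the monomials move it to distinct
indicators, whence their linear independence. -/
theorem regRep_monomial (a b : ℕ) (hb : b < n) :
    regRep hn hq (x hn hq ^ a * y hn hq ^ b) (fun (i : ZMod n) j => if i = 0 ∧ j = 0 then (1 : k) else 0) =
      fun (i : ZMod n) j => if i = a ∧ j = b then 1 else 0 := by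
  rw [map_mul, map_pow, map_pow, regRep, lift_x, lift_y, Module.End.mul_apply]
  ext i j
  rw [regX_pow_apply]
  cases b with
  | zero => simp [sub_eq_zero]
  | succ b =>
    rw [regY_pow_apply]
    by_cases h : i = a ∧ j = b + 1
    · obtain ⟨rfl, rfl⟩ := h
      simp [hb]
    · rw [if_neg h]
      split_ifs with h1 h2
      · exact absurd ⟨sub_eq_zero.mp h2.1, by omega⟩ h
      · simp
      · rfl

theorem linearIndependent_monomial :
    LinearIndependent k fun p : Fin n × Fin n => x hn hq ^ (p.1 : ℕ) * y hn hq ^ (p.2 : ℕ) := by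
  rw [Fintype.linearIndependent_iff]
  intro c hc p
  have h := congrArg (fun a => regRep hn hq a (fun (i : ZMod n) j => if i = 0 ∧ j = 0 then (1 : k) else 0)
    (p.1 : ℕ) (p.2 : ℕ)) hc
  simp only [map_sum, map_smul, LinearMap.sum_apply, LinearMap.smul_apply, Finset.sum_apply,
    Pi.smul_apply, map_zero, LinearMap.zero_apply, Pi.zero_apply] at h
  rw [Finset.sum_eq_single p] at h
  · rw [regRep_monomial hn hq _ _ p.2.2] at h
    simpa using h
  · intro r _ hr
    rw [regRep_monomial hn hq _ _ r.2.2]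
    dsimp only
    rw [if_neg, smul_zero]
    rintro ⟨h1, h2⟩
    rw [ZMod.natCast_eq_natCast_iff', Nat.mod_eq_of_lt p.1.2, Nat.mod_eq_of_lt r.1.2] at h1
    exact hr (Prod.ext (Fin.ext h1.symm) (Fin.ext h2.symm))
  · simp

theorem monomial_mem_span (i j : ℕ) : x hn hq ^ i * y hn hq ^ j ∈
    Submodule.span k (Set.range fun p : Fin n × Fin n =>
      x hn hq ^ (p.1 : ℕ) * y hn hq ^ (p.2 : ℕ)) := by
  rcases lt_or_ge j n with hj | hj
  · rw [← x_pow_mod]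
    exact Submodule.subset_span ⟨(⟨i % n, Nat.mod_lt _ (by omega)⟩, ⟨j, hj⟩), rfl⟩
  · rw [y_pow_of_le hn hq hj, mul_zero]
    exact zero_mem _

theorem span_monomial : ⊤ ≤ Submodule.span k (Set.range fun p : Fin n × Fin n =>
    x hn hq ^ (p.1 : ℕ) * y hn hq ^ (p.2 : ℕ)) := by
  rintro a -
  refine induction hn hq (P := fun a => a ∈ Submodule.span k (Set.range
    fun p : Fin n × Fin n => x hn hq ^ (p.1 : ℕ) * y hn hq ^ (p.2 : ℕ))) ?_ ?_ ?_ ?_ ?_ a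
  · intro r
    rw [Algebra.algebraMap_eq_smul_one]
    exact Submodule.smul_mem _ _ (by simpa using monomial_mem_span hn hq 0 0)
  · simpa using monomial_mem_span hn hq 1 0
  · simpa using monomial_mem_span hn hq 0 1
  · exact fun a b => add_mem
  · intro a b ha hb
    induction ha using Submodule.span_induction with
    | mem u hu =>
      obtain ⟨u, rfl⟩ := hu
      induction hb using Submodule.span_induction with
      | mem v hv =>
        obtain ⟨v, rfl⟩ := hv
        dsimp only
        rw [monomial_mul]
        exact Submodule.smul_mem _ _ (monomial_mem_span hn hq _ _)
      | zero => simp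
      | add v w _ _ h1 h2 => rw [mul_add]; exact add_mem h1 h2
      | smul c v _ h => rw [mul_smul_comm]; exact Submodule.smul_mem _ _ h
    | zero => simp
    | add v w _ _ h1 h2 => rw [add_mul]; exact add_mem h1 h2
    | smul c v _ h => rw [smul_mul_assoc]; exact Submodule.smul_mem _ _ h

/-- The basis of the Taft algebra formed by the monomials `x ^ i * y ^ j`. -/
noncomputable def monomialBasis : Module.Basis (Fin n × Fin n) k (TaftAlgebra hn hq) :=
  Module.Basis.mk (linearIndependent_monomial hn hq) (span_monomial hn hq)

theorem monomialBasis_apply (p : Fin n × Fin n) :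
    monomialBasis hn hq p = x hn hq ^ (p.1 : ℕ) * y hn hq ^ (p.2 : ℕ) :=
  Module.Basis.mk_apply ..

end Basis

/-! ### Convolution inverses of linear maps on the Taft algebra -/

section Convolution

variable {k : Type*} [Field k] {n : ℕ} {q : k} (hn : 2 ≤ n) (hq : IsPrimitiveRoot q n)
  {A : Type*} [Field A] [Algebra k A]

theorem convMul_monomial (f g : WithConv (TaftAlgebra hn hq →ₗ[k] A)) (i j : ℕ) :
    (f * g).ofConv (x hn hq ^ i * y hn hq ^ j) =
      ∑ r ∈ Finset.range (j + 1), qChoose q j r • (f.ofConv (x hn hq ^ i * y hn hq ^ r) *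
        g.ofConv (x hn hq ^ (i + r) * y hn hq ^ (j - r))) := by
  rw [LinearMap.convMul_def]
  simp only [LinearMap.comp_apply, comul_monomial, map_sum, map_smul, TensorProduct.map_tmul,
    LinearMap.mul'_apply]

theorem convOne_monomial (i j : ℕ) :
    (1 : WithConv (TaftAlgebra hn hq →ₗ[k] A)).ofConv (x hn hq ^ i * y hn hq ^ j) =
      if j = 0 then 1 else 0 := by
  rw [LinearMap.convOne_def]
  simp only [LinearMap.comp_apply, counit_monomial]
  split_ifs <;> simp

/-- The values at `x ^ i * y ^ j` of the right convolution inverse of a linear map, by recursion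
on `j`. -/
noncomputable def rightInvAux (f : TaftAlgebra hn hq →ₗ[k] A) (j i : ℕ) : A :=
  (f (x hn hq ^ i))⁻¹ * ((if j = 0 then 1 else 0) - ∑ r : Fin j, qChoose q j (r + 1) •
    (f (x hn hq ^ i * y hn hq ^ (r + 1 : ℕ)) * rightInvAux f (j - (r + 1)) (i + (r + 1))))
termination_by j
decreasing_by omega

/-- The recursion shifts `i` beyond `n`, while `x^i` depends only on `i` modulo `n`; periodicity
makes the recursive values those of a linear map. -/
theorem rightInvAux_congr (f : TaftAlgebra hn hq →ₗ[k] A) (j : ℕ) :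
    ∀ i i' : ℕ, i ≡ i' [MOD n] → rightInvAux hn hq f j i = rightInvAux hn hq f j i' := by
  induction j using Nat.strong_induction_on with
  | _ j ih =>
    intro i i' h
    have hx : x hn hq ^ i = x hn hq ^ i' := by
      rw [← x_pow_mod, show i % n = i' % n from h, x_pow_mod]
    rw [rightInvAux, rightInvAux, hx]
    congr 3
    ext r
    rw [ih (j - (r + 1)) (by omega) _ _ (h.add_right _)]

theorem exists_convMul_eq_one (f : TaftAlgebra hn hq →ₗ[k] A) (hf : ∀ i, f (x hn hq ^ i) ≠ 0) :
    ∃ g : TaftAlgebra hn hq →ₗ[k] A, WithConv.toConv f * WithConv.toConv g = 1 := by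
  obtain ⟨g, hg⟩ : ∃ g : TaftAlgebra hn hq →ₗ[k] A, ∀ i, ∀ j < n,
      g (x hn hq ^ i * y hn hq ^ j) = rightInvAux hn hq f j i := by
    refine ⟨(monomialBasis hn hq).constr k fun p => rightInvAux hn hq f p.2 p.1, ?_⟩
    intro i j hj
    have h := (monomialBasis hn hq).constr_basis k
      (fun p => rightInvAux hn hq f p.2 p.1) (⟨i % n, Nat.mod_lt _ (by omega)⟩, ⟨j, hj⟩)
    rw [monomialBasis_apply] at h
    dsimp only at h
    rw [x_pow_mod] at h
    rw [h, rightInvAux_congr hn hq f j _ _ (Nat.mod_modEq i n)]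
  refine ⟨g, WithConv.ofConv_injective ((monomialBasis hn hq).ext fun p => ?_)⟩
  -- The split-off term `r = 0` is `f(x^i) g(x^i y^j)`, the only one with `g` at the full exponent
  -- `j`; it is what the recursion solves for.
  rw [monomialBasis_apply, convMul_monomial, convOne_monomial, Finset.sum_range_succ']
  simp only [pow_zero, mul_one, add_zero, Nat.sub_zero, qChoose_zero_right,
    one_smul]
  rw [hg _ _ p.2.2, rightInvAux, mul_inv_cancel_left₀ (hf _), ← Fin.sum_univ_eq_sum_range
    (fun r => qChoose q p.2 (r + 1) • (f (x hn hq ^ (p.1 : ℕ) * y hn hq ^ (r + 1)) *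
      g (x hn hq ^ (p.1 + (r + 1) : ℕ) * y hn hq ^ (p.2 - (r + 1) : ℕ))))]
  rw [add_comm, sub_add_eq_add_sub, sub_eq_iff_eq_add]
  congr 1
  refine Finset.sum_congr rfl fun r _ => ?_
  rw [hg _ _ (by omega)]

/-- A right inverse `g` of `f` satisfies `f(x^i) g(x^i) = 1`, so it has a right inverse too; by
associativity that one is `f`. -/
theorem isUnit_toConv (f : TaftAlgebra hn hq →ₗ[k] A) (hf : ∀ i, f (x hn hq ^ i) ≠ 0) :
    IsUnit (WithConv.toConv f) := by
  obtain ⟨g, hg⟩ := exists_convMul_eq_one hn hq f hf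
  obtain ⟨h, hh⟩ := exists_convMul_eq_one hn hq g fun i hi => by
    have h1 := congrArg (fun u => u.ofConv (x hn hq ^ i * y hn hq ^ 0)) hg
    rw [convMul_monomial, convOne_monomial] at h1
    simp [hi] at h1
  have hfh : WithConv.toConv h = WithConv.toConv f := by
    rw [← one_mul (WithConv.toConv h), ← hg, mul_assoc, hh, mul_one]
  exact ⟨⟨_, _, hg, hfh ▸ hh⟩, rfl⟩

end Convolution

/-! ### The generic elements and the cocycle on monomials -/

section Generic

open GenericBase

variable {k : Type*} [Field k] {n : ℕ} {q : k} (hn : 2 ≤ n) (hq : IsPrimitiveRoot q n)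

/-- The monomial basis identifies the symmetric algebra with a polynomial ring, and passing to
fractions is an algebraic extension. -/
theorem isTranscendenceBasis_t : IsTranscendenceBasis k fun p : Fin n × Fin n =>
    t k (TaftAlgebra hn hq) (x hn hq ^ (p.1 : ℕ) * y hn hq ^ (p.2 : ℕ)) := by
  have h := (SymmetricAlgebra.equivMvPolynomial (monomialBasis hn hq)).symm.isTranscendenceBasis
    (IsTranscendenceBasis.mvPolynomial (Fin n × Fin n) k)
  have : Algebra.IsAlgebraic (SymmetricAlgebra k (TaftAlgebra hn hq))
    (FracSym k (TaftAlgebra hn hq)) := IsLocalization.isAlgebraic _ (nonZeroDivisors _)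
  convert h.algebraMap_comp (A := FracSym k (TaftAlgebra hn hq)) using 2 with p
  simp [t, monomialBasis_apply]

theorem t_x_pow_ne_zero (i : ℕ) : t k (TaftAlgebra hn hq) (x hn hq ^ i) ≠ 0 := by
  have h := (isTranscendenceBasis_t hn hq).1.ne_zero
    (⟨i % n, Nat.mod_lt _ (by omega)⟩, ⟨0, by omega⟩)
  simpa [x_pow_mod] using h

/-- `Ring.inverse` is zero off the units, so `tInv` is meaningful only once `t` is known to be
convolution invertible. -/
theorem t_mul_tInv : WithConv.toConv (t k (TaftAlgebra hn hq)) *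
    WithConv.toConv (tInv k (TaftAlgebra hn hq)) = 1 :=
  Ring.mul_inverse_cancel _ (isUnit_toConv hn hq _ (t_x_pow_ne_zero hn hq))

theorem sum_t_mul_tInv (i j : ℕ) :
    ∑ r ∈ Finset.range (j + 1), qChoose q j r •
      (t k (TaftAlgebra hn hq) (x hn hq ^ i * y hn hq ^ r) *
        tInv k (TaftAlgebra hn hq) (x hn hq ^ (i + r) * y hn hq ^ (j - r))) =
      if j = 0 then 1 else 0 := by
  rw [← convOne_monomial hn hq i j, ← t_mul_tInv, convMul_monomial]

theorem tInv_x_pow (i : ℕ) :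
    tInv k (TaftAlgebra hn hq) (x hn hq ^ i) = (t k (TaftAlgebra hn hq) (x hn hq ^ i))⁻¹ := by
  have h := sum_t_mul_tInv hn hq i 0
  simp only [zero_add, Finset.sum_range_one, pow_zero, mul_one, qChoose_zero_right, add_zero,
    one_smul, if_true, Nat.sub_zero] at h
  exact eq_inv_of_mul_eq_one_right h

theorem tInv_monomial_succ (i j : ℕ) :
    tInv k (TaftAlgebra hn hq) (x hn hq ^ i * y hn hq ^ (j + 1)) =
      -(t k (TaftAlgebra hn hq) (x hn hq ^ i))⁻¹ * ∑ r ∈ Finset.range (j + 1),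
        qChoose q (j + 1) (r + 1) •
          (t k (TaftAlgebra hn hq) (x hn hq ^ i * y hn hq ^ (r + 1)) *
            tInv k (TaftAlgebra hn hq) (x hn hq ^ (i + (r + 1)) * y hn hq ^ (j - r))) := by
  have h := sum_t_mul_tInv hn hq i (j + 1)
  rw [Finset.sum_range_succ'] at h
  simp only [pow_zero, mul_one, add_zero, Nat.sub_zero, qChoose_zero_right,
    one_smul, Nat.add_sub_add_right, if_neg (Nat.succ_ne_zero j)] at h
  rw [neg_mul, eq_neg_iff_add_eq_zero, ← mul_right_inj' (t_x_pow_ne_zero hn hq i), mul_zero,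
    mul_add, mul_inv_cancel_left₀ (t_x_pow_ne_zero hn hq i), add_comm, h]

theorem sigma_monomial (a b c d : ℕ) :
    sigma k (TaftAlgebra hn hq)
      ((x hn hq ^ a * y hn hq ^ b) ⊗ₜ[k] (x hn hq ^ c * y hn hq ^ d)) =
    ∑ r ∈ Finset.range (b + 1), ∑ s ∈ Finset.range (d + 1), (qChoose q b r * qChoose q d s) •
      (t k (TaftAlgebra hn hq) (x hn hq ^ a * y hn hq ^ r) *
        t k (TaftAlgebra hn hq) (x hn hq ^ c * y hn hq ^ s) *
        tInv k (TaftAlgebra hn hq) ((x hn hq ^ (a + r) * y hn hq ^ (b - r)) *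
          (x hn hq ^ (c + s) * y hn hq ^ (d - s)))) := by
  rw [sigma, LinearMap.convMul_def]
  simp only [LinearMap.comp_apply, TensorProduct.comul_tmul,
    comul_monomial, TensorProduct.sum_tmul, TensorProduct.tmul_sum, map_sum]
  rw [Finset.sum_comm]
  refine Finset.sum_congr rfl fun r _ => Finset.sum_congr rfl fun s _ => ?_
  simp [TensorProduct.smul_tmul', TensorProduct.tmul_smul, smul_smul, mul_comm (qChoose q b r)]

theorem sigmaInv_monomial (a b c d : ℕ) :
    sigmaInv k (TaftAlgebra hn hq)
      ((x hn hq ^ a * y hn hq ^ b) ⊗ₜ[k] (x hn hq ^ c * y hn hq ^ d)) =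
    ∑ r ∈ Finset.range (b + 1), ∑ s ∈ Finset.range (d + 1), (qChoose q b r * qChoose q d s) •
      (t k (TaftAlgebra hn hq) ((x hn hq ^ a * y hn hq ^ r) * (x hn hq ^ c * y hn hq ^ s)) *
        (tInv k (TaftAlgebra hn hq) (x hn hq ^ (a + r) * y hn hq ^ (b - r)) *
          tInv k (TaftAlgebra hn hq) (x hn hq ^ (c + s) * y hn hq ^ (d - s)))) := by
  rw [sigmaInv, LinearMap.convMul_def]
  simp only [LinearMap.comp_apply, TensorProduct.comul_tmul,
    comul_monomial, TensorProduct.sum_tmul, TensorProduct.tmul_sum, map_sum]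
  rw [Finset.sum_comm]
  refine Finset.sum_congr rfl fun r _ => Finset.sum_congr rfl fun s _ => ?_
  simp [TensorProduct.smul_tmul', TensorProduct.tmul_smul, smul_smul, mul_comm (qChoose q b r)]

end Generic

/-! ### The base algebra lies in `k[Γ₀, Γ₀⁻¹, Γ₁]` -/

section Monomials

open GenericBase

variable {k : Type*} [Field k] {n : ℕ} {q : k} (hn : 2 ≤ n) (hq : IsPrimitiveRoot q n)

/-- The element `t_{x ^ i * y ^ j}`. -/
noncomputable def tMon (i j : ℕ) : FracSym k (TaftAlgebra hn hq) :=
  t k (TaftAlgebra hn hq) (x hn hq ^ i * y hn hq ^ j)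

/-- The element `t⁻¹_{x ^ i * y ^ j}`. -/
noncomputable def tInvMon (i j : ℕ) : FracSym k (TaftAlgebra hn hq) :=
  tInv k (TaftAlgebra hn hq) (x hn hq ^ i * y hn hq ^ j)

theorem t_x_pow (i : ℕ) : t k (TaftAlgebra hn hq) (x hn hq ^ i) = tMon hn hq i 0 := by
  rw [tMon, pow_zero, mul_one]

theorem t_x : t k (TaftAlgebra hn hq) (x hn hq) = tMon hn hq 1 0 := by
  rw [← t_x_pow, pow_one]

theorem tMon_ne_zero (i : ℕ) : tMon hn hq i 0 ≠ 0 := by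
  rw [← t_x_pow]
  exact t_x_pow_ne_zero hn hq i

theorem tMon_mod (i j : ℕ) : tMon hn hq (i % n) j = tMon hn hq i j := by
  rw [tMon, x_pow_mod, tMon]

theorem tMon_add_self (i j : ℕ) : tMon hn hq (i + n) j = tMon hn hq i j := by
  rw [← tMon_mod, Nat.add_mod_right, tMon_mod]

theorem tMon_of_le (i : ℕ) {j : ℕ} (h : n ≤ j) : tMon hn hq i j = 0 := by
  rw [tMon, y_pow_of_le hn hq h, mul_zero, map_zero]

theorem tInvMon_zero (i : ℕ) : tInvMon hn hq i 0 = (tMon hn hq i 0)⁻¹ := by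
  rw [tInvMon, pow_zero, mul_one, tInv_x_pow, t_x_pow]

theorem tInvMon_succ (i j : ℕ) : tInvMon hn hq i (j + 1) =
    -(tMon hn hq i 0)⁻¹ * ∑ r ∈ Finset.range (j + 1), qChoose q (j + 1) (r + 1) •
      (tMon hn hq i (r + 1) * tInvMon hn hq (i + (r + 1)) (j - r)) := by
  rw [tInvMon, tInv_monomial_succ, t_x_pow]
  rfl

theorem sigma_monomial_eq_sum (a b c d : ℕ) :
    sigma k (TaftAlgebra hn hq)
      ((x hn hq ^ a * y hn hq ^ b) ⊗ₜ[k] (x hn hq ^ c * y hn hq ^ d)) =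
    ∑ r ∈ Finset.range (b + 1), ∑ s ∈ Finset.range (d + 1),
      (qChoose q b r * qChoose q d s * q ^ ((c + s) * (b - r))) •
      (tMon hn hq a r * tMon hn hq c s *
        tInvMon hn hq (a + r + (c + s)) (b - r + (d - s))) := by
  rw [sigma_monomial]
  simp only [monomial_mul, map_smul, mul_smul_comm, smul_smul]
  rfl

theorem sigmaInv_monomial_eq_sum (a b c d : ℕ) :
    sigmaInv k (TaftAlgebra hn hq)
      ((x hn hq ^ a * y hn hq ^ b) ⊗ₜ[k] (x hn hq ^ c * y hn hq ^ d)) =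
    ∑ r ∈ Finset.range (b + 1), ∑ s ∈ Finset.range (d + 1),
      (qChoose q b r * qChoose q d s * q ^ (c * r)) •
      (tMon hn hq (a + c) (r + s) *
        (tInvMon hn hq (a + r) (b - r) * tInvMon hn hq (c + s) (d - s))) := by
  rw [sigmaInv_monomial]
  simp only [monomial_mul, map_smul, smul_mul_assoc, smul_smul]
  rfl

/-- The recursion for `t⁻¹` is homogeneous, so powers of `u` cancel term by term. The bound `m` lets
the lemma serve inside an induction, where only smaller exponents of `y` are known to be handled. -/
theorem tInvMon_mul_pow_mem (A : Subalgebra k (FracSym k (TaftAlgebra hn hq)))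
    (hg : ∀ i, tMon hn hq 1 0 ^ i / tMon hn hq i 0 ∈ A) (m : ℕ)
    (hz : ∀ j < m, ∀ i, tMon hn hq i j / tMon hn hq 1 0 ^ (i + j) ∈ A) :
    ∀ j < m, ∀ i, tInvMon hn hq i j * tMon hn hq 1 0 ^ i ∈ A := by
  have hu := tMon_ne_zero hn hq 1
  intro j
  induction j using Nat.strong_induction_on with
  | _ j ih =>
    intro hj i
    cases j with
    | zero => simpa [tInvMon_zero, div_eq_inv_mul] using hg i
    | succ j =>
      have key : tInvMon hn hq i (j + 1) * tMon hn hq 1 0 ^ i =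
          -((tMon hn hq 1 0 ^ i / tMon hn hq i 0) * ∑ r ∈ Finset.range (j + 1),
            qChoose q (j + 1) (r + 1) • ((tMon hn hq i (r + 1) / tMon hn hq 1 0 ^ (i + (r + 1))) *
            (tInvMon hn hq (i + (r + 1)) (j - r) * tMon hn hq 1 0 ^ (i + (r + 1))))) := by
        have h : ∀ r, tMon hn hq i (r + 1) / tMon hn hq 1 0 ^ (i + (r + 1)) *
            (tInvMon hn hq (i + (r + 1)) (j - r) * tMon hn hq 1 0 ^ (i + (r + 1))) =
            tMon hn hq i (r + 1) * tInvMon hn hq (i + (r + 1)) (j - r) := fun r => by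
          field_simp
        simp only [h]
        rw [tInvMon_succ]
        ring
      rw [key]
      refine neg_mem (mul_mem (hg i) (sum_mem fun r hr => A.smul_mem (mul_mem ?_ ?_) _))
      · exact hz _ (by have := Finset.mem_range.mp hr; omega) i
      · exact ih _ (by omega) (by omega) _

theorem map_tensor_mem (A : Subalgebra k (FracSym k (TaftAlgebra hn hq)))
    (f : TaftAlgebra hn hq ⊗[k] TaftAlgebra hn hq →ₗ[k] FracSym k (TaftAlgebra hn hq))
    (h : ∀ a b c d : ℕ,
      f ((x hn hq ^ a * y hn hq ^ b) ⊗ₜ[k] (x hn hq ^ c * y hn hq ^ d)) ∈ A)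
    (w : TaftAlgebra hn hq ⊗[k] TaftAlgebra hn hq) : f w ∈ A := by
  have hw := ((monomialBasis hn hq).tensorProduct (monomialBasis hn hq)).mem_span w
  refine (Submodule.span_le (p := (Subalgebra.toSubmodule A).comap f)).mpr ?_ hw
  rintro _ ⟨p, rfl⟩
  rw [Module.Basis.tensorProduct_apply, monomialBasis_apply, monomialBasis_apply]
  exact h _ _ _ _

/-- The subalgebra `k[Γ₀, Γ₀⁻¹, Γ₁]`. -/
noncomputable def gammaAlgebra : Subalgebra k (FracSym k (TaftAlgebra hn hq)) :=
  Algebra.adjoin k (Gamma0 hn hq ∪ Gamma0Inv hn hq ∪ Gamma1 hn hq)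

theorem gammaAlgebra_of_mem {g : FracSym k (TaftAlgebra hn hq)} (h : g ∈ Gamma0 hn hq) :
    g ∈ gammaAlgebra hn hq :=
  Algebra.subset_adjoin (Or.inl (Or.inl h))

theorem gammaAlgebra_inv_of_mem {g : FracSym k (TaftAlgebra hn hq)} (h : g ∈ Gamma0 hn hq) :
    g⁻¹ ∈ gammaAlgebra hn hq :=
  Algebra.subset_adjoin (Or.inl (Or.inr ⟨g, h, rfl⟩))

theorem ratio_mem_Gamma0 {i : ℕ} (hi : i < n) (hi1 : i ≠ 1) :
    tMon hn hq i 0 / tMon hn hq 1 0 ^ i ∈ Gamma0 hn hq :=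
  Or.inr ⟨i, hi, hi1, by rw [t_x_pow, t_x]⟩

theorem prod_mem_Gamma0 : tMon hn hq 1 0 * tMon hn hq (n - 1) 0 ∈ Gamma0 hn hq :=
  Or.inl (by rw [t_x_pow, t_x]; rfl)

theorem pow_eq_prod_div_ratio : tMon hn hq 1 0 ^ n =
    (tMon hn hq 1 0 * tMon hn hq (n - 1) 0) /
      (tMon hn hq (n - 1) 0 / tMon hn hq 1 0 ^ (n - 1)) := by
  have h1 := tMon_ne_zero hn hq 1
  have h2 := tMon_ne_zero hn hq (n - 1)
  field_simp
  rw [← pow_succ', Nat.sub_add_cancel (by omega)]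

/-- `3 ≤ n` gives `n - 1 ≠ 1`, so that `t_{x^(n-1)} / u^(n-1)` is one of the elements of `Γ₀`. -/
theorem pow_mem_gammaAlgebra (hn3 : 3 ≤ n) {m : ℕ} (hm : n ∣ m) :
    tMon hn hq 1 0 ^ m ∈ gammaAlgebra hn hq := by
  obtain ⟨m, rfl⟩ := hm
  rw [pow_mul, pow_eq_prod_div_ratio, div_eq_mul_inv]
  exact pow_mem (mul_mem (gammaAlgebra_of_mem hn hq (prod_mem_Gamma0 hn hq))
    (gammaAlgebra_inv_of_mem hn hq (ratio_mem_Gamma0 hn hq (by omega) (by omega)))) _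

theorem inv_pow_mem_gammaAlgebra (hn3 : 3 ≤ n) {m : ℕ} (hm : n ∣ m) :
    (tMon hn hq 1 0 ^ m)⁻¹ ∈ gammaAlgebra hn hq := by
  obtain ⟨m, rfl⟩ := hm
  rw [pow_mul, ← inv_pow, pow_eq_prod_div_ratio, inv_div, div_eq_mul_inv]
  exact pow_mem (mul_mem
    (gammaAlgebra_of_mem hn hq (ratio_mem_Gamma0 hn hq (by omega) (by omega)))
    (gammaAlgebra_inv_of_mem hn hq (prod_mem_Gamma0 hn hq))) _

theorem ratio_eq_mod (i : ℕ) : tMon hn hq i 0 / tMon hn hq 1 0 ^ i =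
    tMon hn hq (i % n) 0 / tMon hn hq 1 0 ^ (i % n) * (tMon hn hq 1 0 ^ (n * (i / n)))⁻¹ := by
  rw [tMon_mod]
  conv_lhs => rw [← Nat.mod_add_div i n, pow_add, Nat.mod_add_div i n]
  rw [div_mul_eq_div_div, div_eq_mul_inv _ (tMon hn hq 1 0 ^ (n * (i / n)))]

theorem ratio_mem_gammaAlgebra (hn3 : 3 ≤ n) (i : ℕ) :
    tMon hn hq i 0 / tMon hn hq 1 0 ^ i ∈ gammaAlgebra hn hq := by
  rw [ratio_eq_mod]
  refine mul_mem ?_ (inv_pow_mem_gammaAlgebra hn hq hn3 ⟨_, rfl⟩)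
  by_cases h : i % n = 1
  · rw [h, pow_one, div_self (tMon_ne_zero hn hq 1)]
    exact one_mem _
  · exact gammaAlgebra_of_mem hn hq (ratio_mem_Gamma0 hn hq (Nat.mod_lt _ (by omega)) h)

theorem inv_ratio_mem_gammaAlgebra (hn3 : 3 ≤ n) (i : ℕ) :
    tMon hn hq 1 0 ^ i / tMon hn hq i 0 ∈ gammaAlgebra hn hq := by
  rw [← inv_div, ratio_eq_mod, mul_inv, inv_inv]
  refine mul_mem ?_ (pow_mem_gammaAlgebra hn hq hn3 ⟨_, rfl⟩)
  by_cases h : i % n = 1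
  · rw [h, pow_one, div_self (tMon_ne_zero hn hq 1), inv_one]
    exact one_mem _
  · exact gammaAlgebra_inv_of_mem hn hq (ratio_mem_Gamma0 hn hq (Nat.mod_lt _ (by omega)) h)

theorem tMon_div_pow_mem_gammaAlgebra (hn3 : 3 ≤ n) (i j : ℕ) :
    tMon hn hq i j / tMon hn hq 1 0 ^ (i + j) ∈ gammaAlgebra hn hq := by
  have hu := tMon_ne_zero hn hq 1
  rcases le_or_gt n j with hj | hj
  · rw [tMon_of_le hn hq i hj, zero_div]
    exact zero_mem _
  rcases Nat.eq_zero_or_pos j with rfl | hj0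
  · exact ratio_mem_gammaAlgebra hn hq hn3 i
  -- `l` is the residue of `-(i + j)`; the outer reduction matters when `n` divides `i + j`.
  obtain ⟨l, hl, hdvd⟩ : ∃ l < n, n ∣ i + j + l := by
    have h := Nat.mod_lt (i + j) (show 0 < n by omega)
    have h' := Nat.mod_add_div (i + j) n
    refine ⟨(n - (i + j) % n) % n, Nat.mod_lt _ (by omega), ?_⟩
    rw [Nat.dvd_iff_mod_eq_zero, Nat.add_mod_mod,
      show i + j + (n - (i + j) % n) = n * ((i + j) / n) + n by omega, Nat.add_mod_right,
      Nat.mul_mod_right]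
  have hl0 := tMon_ne_zero hn hq l
  have hmem : tMon hn hq i j * tMon hn hq l 0 ∈ gammaAlgebra hn hq := by
    refine Algebra.subset_adjoin (Or.inr ⟨i % n, j, l, Nat.mod_lt _ (by omega), hj, hl,
      by omega, ?_, ?_⟩)
    · refine Nat.ModEq.trans ?_ ((Nat.modEq_zero_iff_dvd).mpr hdvd)
      exact ((Nat.mod_modEq i n).add_right _).add_right _
    · rw [x_pow_mod, t_x_pow, tMon]
  have key : tMon hn hq i j / tMon hn hq 1 0 ^ (i + j) = tMon hn hq i j * tMon hn hq l 0 *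
      (tMon hn hq 1 0 ^ l / tMon hn hq l 0) * (tMon hn hq 1 0 ^ (i + j + l))⁻¹ := by
    field_simp
    ring
  rw [key]
  exact mul_mem (mul_mem hmem (inv_ratio_mem_gammaAlgebra hn hq hn3 l))
    (inv_pow_mem_gammaAlgebra hn hq hn3 hdvd)

theorem tInvMon_mul_pow_mem_gammaAlgebra (hn3 : 3 ≤ n) (i j : ℕ) :
    tInvMon hn hq i j * tMon hn hq 1 0 ^ i ∈ gammaAlgebra hn hq :=
  tInvMon_mul_pow_mem hn hq _ (inv_ratio_mem_gammaAlgebra hn hq hn3) (j + 1)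
    (fun j _ i => tMon_div_pow_mem_gammaAlgebra hn hq hn3 i j) j j.lt_succ_self i

/-- In each term of `σ` and `σ⁻¹` the normalising powers of `u` cancel exactly. -/
theorem baseAlgebra_le_gammaAlgebra (hn3 : 3 ≤ n) :
    baseAlgebra k (TaftAlgebra hn hq) ≤ gammaAlgebra hn hq := by
  have hu := tMon_ne_zero hn hq 1
  have hz := tMon_div_pow_mem_gammaAlgebra hn hq hn3
  have hs := tInvMon_mul_pow_mem_gammaAlgebra hn hq hn3
  refine Algebra.adjoin_le ?_
  rintro _ (⟨p, rfl⟩ | ⟨p, rfl⟩)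
  · refine map_tensor_mem hn hq _ _ (fun a b c d => ?_) _
    rw [sigma_monomial_eq_sum]
    refine sum_mem fun r _ => sum_mem fun s _ => Subalgebra.smul_mem _ ?_ _
    convert mul_mem (mul_mem (hz a r) (hz c s))
      (hs (a + r + (c + s)) (b - r + (d - s))) using 1
    field_simp
    ring
  · refine map_tensor_mem hn hq _ _ (fun a b c d => ?_) _
    rw [sigmaInv_monomial_eq_sum]
    refine sum_mem fun r _ => sum_mem fun s _ => Subalgebra.smul_mem _ ?_ _
    convert mul_mem (hz (a + c) (r + s)) (mul_mem (hs (a + r) (b - r))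
      (hs (c + s) (d - s))) using 1
    field_simp
    ring

end Monomials

/-! ### The base algebra contains `k[Γ₀, Γ₀⁻¹, Γ₁]` -/

section Generators

open GenericBase

variable {k : Type*} [Field k] {n : ℕ} {q : k} (hn : 2 ≤ n) (hq : IsPrimitiveRoot q n)

theorem sigma_mem_baseAlgebra (a b : TaftAlgebra hn hq) :
    sigma k (TaftAlgebra hn hq) (a ⊗ₜ b) ∈ baseAlgebra k (TaftAlgebra hn hq) :=
  Algebra.subset_adjoin (Or.inl ⟨(a, b), rfl⟩)

theorem sigmaInv_mem_baseAlgebra (a b : TaftAlgebra hn hq) :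
    sigmaInv k (TaftAlgebra hn hq) (a ⊗ₜ b) ∈ baseAlgebra k (TaftAlgebra hn hq) :=
  Algebra.subset_adjoin (Or.inr ⟨(a, b), rfl⟩)

theorem cocycle_ratio_mem (i j : ℕ) : tMon hn hq i 0 * tMon hn hq j 0 / tMon hn hq (i + j) 0 ∈
    baseAlgebra k (TaftAlgebra hn hq) := by
  have h := sigma_mem_baseAlgebra hn hq (x hn hq ^ i * y hn hq ^ 0) (x hn hq ^ j * y hn hq ^ 0)
  rw [sigma_monomial_eq_sum] at h
  simpa [qChoose_zero_right, tInvMon_zero, div_eq_mul_inv] using h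

theorem inv_cocycle_ratio_mem (i j : ℕ) :
    tMon hn hq (i + j) 0 / (tMon hn hq i 0 * tMon hn hq j 0) ∈
    baseAlgebra k (TaftAlgebra hn hq) := by
  have h := sigmaInv_mem_baseAlgebra hn hq (x hn hq ^ i * y hn hq ^ 0)
    (x hn hq ^ j * y hn hq ^ 0)
  rw [sigmaInv_monomial_eq_sum] at h
  simpa [qChoose_zero_right, tInvMon_zero, div_eq_mul_inv, mul_comm] using h

/-- Telescoping product of the values `σ(x^i, x)`, starting from `1 / t_1 = σ⁻¹(1, 1)`. -/
theorem inv_ratio_mem_baseAlgebra (i : ℕ) :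
    tMon hn hq 1 0 ^ i / tMon hn hq i 0 ∈ baseAlgebra k (TaftAlgebra hn hq) := by
  induction i with
  | zero =>
    have h := inv_cocycle_ratio_mem hn hq 0 0
    have h0 := tMon_ne_zero hn hq 0
    rw [add_zero] at h
    convert h using 1
    field_simp
  | succ i ih =>
    have h0 := tMon_ne_zero hn hq i
    convert mul_mem ih (cocycle_ratio_mem hn hq i 1) using 1
    field_simp
    ring

theorem ratio_mem_baseAlgebra (i : ℕ) :
    tMon hn hq i 0 / tMon hn hq 1 0 ^ i ∈ baseAlgebra k (TaftAlgebra hn hq) := by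
  induction i with
  | zero =>
    have h := cocycle_ratio_mem hn hq 0 0
    have h0 := tMon_ne_zero hn hq 0
    rw [add_zero] at h
    convert h using 1
    field_simp
  | succ i ih =>
    have h0 := tMon_ne_zero hn hq i
    convert mul_mem ih (inv_cocycle_ratio_mem hn hq i 1) using 1
    field_simp
    ring

theorem pow_mem_baseAlgebra {m : ℕ} (hm : n ∣ m) :
    tMon hn hq 1 0 ^ m ∈ baseAlgebra k (TaftAlgebra hn hq) := by
  obtain ⟨m, rfl⟩ := hm
  rw [pow_mul]
  refine pow_mem ?_ _
  have h0 := tMon_ne_zero hn hq n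
  -- As `x^n = 1`, the product of `u^n / t_{x^n}` and `t_1` is `u^n`.
  have h := mul_mem (inv_ratio_mem_baseAlgebra hn hq n) (ratio_mem_baseAlgebra hn hq 0)
  rwa [pow_zero, div_one, ← tMon_add_self hn hq 0, zero_add, div_mul_cancel₀ _ h0] at h

theorem inv_pow_mem_baseAlgebra {m : ℕ} (hm : n ∣ m) :
    (tMon hn hq 1 0 ^ m)⁻¹ ∈ baseAlgebra k (TaftAlgebra hn hq) := by
  obtain ⟨m, rfl⟩ := hm
  rw [pow_mul, ← inv_pow]
  refine pow_mem ?_ _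
  have h0 := tMon_ne_zero hn hq n
  have h := mul_mem (ratio_mem_baseAlgebra hn hq n) (inv_ratio_mem_baseAlgebra hn hq 0)
  rwa [pow_zero, ← tMon_add_self hn hq 0, zero_add, div_mul_div_comm, mul_comm (_ ^ n),
    mul_div_mul_left _ _ h0, one_div] at h

/-- The two values differ only by the factor `q^r` from moving `x` past `y^r`; subtracting kills the
term `r = 0`. -/
theorem sigmaInv_sub_sigmaInv (a j : ℕ) :
    sigmaInv k (TaftAlgebra hn hq) ((x hn hq ^ a * y hn hq ^ j) ⊗ₜ[k] x hn hq) -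
      sigmaInv k (TaftAlgebra hn hq) (x hn hq ⊗ₜ[k] (x hn hq ^ a * y hn hq ^ j)) =
    ∑ r ∈ Finset.range (j + 1), (qChoose q j r * (q ^ r - 1)) •
      (tMon hn hq (a + 1) r * tInvMon hn hq (a + r) (j - r) / tMon hn hq 1 0) := by
  have h1 := sigmaInv_monomial_eq_sum hn hq a j 1 0
  have h2 := sigmaInv_monomial_eq_sum hn hq 1 0 a j
  simp only [pow_one, pow_zero, mul_one, zero_add, Finset.sum_range_one, qChoose_zero_right,
    one_mul, add_zero, Nat.sub_zero, mul_zero, tInvMon_zero] at h1 h2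
  rw [h1, h2, ← Finset.sum_sub_distrib]
  refine Finset.sum_congr rfl fun r _ => ?_
  rw [add_comm 1 a, mul_sub, sub_smul, mul_one]
  congr 2 <;> ring

theorem tMon_div_pow_mem_baseAlgebra (j : ℕ) : ∀ i,
    tMon hn hq i j / tMon hn hq 1 0 ^ (i + j) ∈ baseAlgebra k (TaftAlgebra hn hq) := by
  have hu := tMon_ne_zero hn hq 1
  induction j using Nat.strong_induction_on with
  | _ j ih =>
    have hs := tInvMon_mul_pow_mem hn hq _ (inv_ratio_mem_baseAlgebra hn hq) j ih
    -- The cocycle identity reaches only indices `a + 1`; index `i` is recovered as `i + n` at the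
    -- cost of a factor `u^n`.
    suffices h : ∀ a, tMon hn hq (a + 1) j / tMon hn hq 1 0 ^ (a + 1 + j) ∈
        baseAlgebra k (TaftAlgebra hn hq) by
      intro i
      have hi := mul_mem (h (i + (n - 1))) (pow_mem_baseAlgebra hn hq dvd_rfl)
      rw [show i + (n - 1) + 1 = i + n by omega, tMon_add_self] at hi
      convert hi using 1
      field_simp
      ring
    intro a
    rcases Nat.eq_zero_or_pos j with rfl | hj0
    · exact ratio_mem_baseAlgebra hn hq (a + 1)
    rcases le_or_gt n j with hj | hj
    · rw [tMon_of_le hn hq _ hj, zero_div]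
      exact zero_mem _
    have hne : q ^ j - 1 ≠ 0 := sub_ne_zero.mpr (hq.pow_ne_one_of_pos_of_lt hj0.ne' hj)
    have hdiff := sigmaInv_sub_sigmaInv hn hq a j
    rw [Finset.sum_range_succ, qChoose_self, one_mul, Nat.sub_self, tInvMon_zero,
      ← sub_eq_iff_eq_add'] at hdiff
    have hmem : (q ^ j - 1) • (tMon hn hq (a + 1) j * (tMon hn hq (a + j) 0)⁻¹ /
        tMon hn hq 1 0) ∈ baseAlgebra k (TaftAlgebra hn hq) := by
      rw [← hdiff]
      refine sub_mem (sub_mem (sigmaInv_mem_baseAlgebra hn hq _ _) (sigmaInv_mem_baseAlgebra hn hq _ _))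
        (sum_mem fun r hr => ?_)
      have hr' := Finset.mem_range.mp hr
      -- The term `r = 0` involves `t⁻¹_{x^a y^j}`, out of reach of the induction, but its
      -- coefficient `q^0 - 1` vanishes.
      rcases Nat.eq_zero_or_pos r with rfl | hr0
      · simp
      · refine Subalgebra.smul_mem _ ?_ _
        convert mul_mem (ih r hr' (a + 1)) (hs (j - r) (by omega) (a + r)) using 1
        field_simp
        ring
    have h2 := mul_mem (Subalgebra.smul_mem _ hmem (q ^ j - 1)⁻¹)
      (ratio_mem_baseAlgebra hn hq (a + j))
    rw [inv_smul_smul₀ hne] at h2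
    have h0 := tMon_ne_zero hn hq (a + j)
    convert h2 using 1
    field_simp
    ring

theorem gammaAlgebra_le_baseAlgebra :
    gammaAlgebra hn hq ≤ baseAlgebra k (TaftAlgebra hn hq) := by
  have hu := tMon_ne_zero hn hq 1
  have hprod : tMon hn hq 1 0 * tMon hn hq (n - 1) 0 = tMon hn hq 1 0 ^ n *
      (tMon hn hq (n - 1) 0 / tMon hn hq 1 0 ^ (n - 1)) := by
    rw [show tMon hn hq 1 0 ^ n = tMon hn hq 1 0 ^ (n - 1 + 1) by
      rw [Nat.sub_add_cancel (by omega)]]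
    field_simp
    ring
  refine Algebra.adjoin_le ?_
  rintro g ((hg | ⟨g, hg, rfl⟩) | ⟨i, j, l, -, -, -, -, hmod, rfl⟩)
  · rcases hg with rfl | ⟨i, -, -, rfl⟩
    · rw [t_x, t_x_pow, hprod]
      exact mul_mem (pow_mem_baseAlgebra hn hq dvd_rfl) (ratio_mem_baseAlgebra hn hq _)
    · rw [t_x, t_x_pow]
      exact ratio_mem_baseAlgebra hn hq _
  · rcases hg with rfl | ⟨i, -, -, rfl⟩
    · rw [t_x, t_x_pow, hprod, mul_inv, inv_div]
      exact mul_mem (inv_pow_mem_baseAlgebra hn hq dvd_rfl) (inv_ratio_mem_baseAlgebra hn hq _)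
    · rw [t_x, t_x_pow, inv_div]
      exact inv_ratio_mem_baseAlgebra hn hq _
  · rw [t_x_pow]
    change tMon hn hq i j * tMon hn hq l 0 ∈ baseAlgebra k (TaftAlgebra hn hq)
    convert mul_mem (mul_mem (tMon_div_pow_mem_baseAlgebra hn hq j i)
      (ratio_mem_baseAlgebra hn hq l))
      (pow_mem_baseAlgebra hn hq (Nat.modEq_zero_iff_dvd.mp hmod)) using 1
    field_simp
    ring

theorem baseAlgebra_eq_gammaAlgebra (hn3 : 3 ≤ n) :
    baseAlgebra k (TaftAlgebra hn hq) = gammaAlgebra hn hq :=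
  le_antisymm (baseAlgebra_le_gammaAlgebra hn hq hn3) (gammaAlgebra_le_baseAlgebra hn hq)

end Generators

/-! ### The automorphism that detects degrees -/

section Automorphism

open GenericBase

variable {k : Type*} [Field k] {n : ℕ} {q : k} (hn : 2 ≤ n) (hq : IsPrimitiveRoot q n)

/-- The linear map that multiplies `x ^ i * y ^ j` by `c ^ (i + j)`, for `i, j < n`. -/
noncomputable def scaleLin (c : k) : TaftAlgebra hn hq →ₗ[k] TaftAlgebra hn hq :=
  (monomialBasis hn hq).constr k fun p => c ^ (p.1 + p.2 : ℕ) • monomialBasis hn hq p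

theorem scaleLin_basis (c : k) (p : Fin n × Fin n) :
    scaleLin hn hq c (monomialBasis hn hq p) = c ^ (p.1 + p.2 : ℕ) • monomialBasis hn hq p :=
  (monomialBasis hn hq).constr_basis k _ p

/-- The algebra endomorphism of the symmetric algebra induced by `scaleLin`. -/
noncomputable def scaleSym (c : k) : SymmetricAlgebra k (TaftAlgebra hn hq) →ₐ[k]
    SymmetricAlgebra k (TaftAlgebra hn hq) :=
  SymmetricAlgebra.lift (SymmetricAlgebra.ι k _ ∘ₗ scaleLin hn hq c)

theorem scaleSym_ι_basis (c : k) (p : Fin n × Fin n) :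
    scaleSym hn hq c (SymmetricAlgebra.ι k _ (monomialBasis hn hq p)) =
      c ^ (p.1 + p.2 : ℕ) • SymmetricAlgebra.ι k _ (monomialBasis hn hq p) := by
  rw [scaleSym, SymmetricAlgebra.lift_ι_apply, LinearMap.comp_apply, scaleLin_basis, map_smul]

theorem scaleSym_comp {c d : k} (h : c * d = 1) :
    (scaleSym hn hq c).comp (scaleSym hn hq d) = AlgHom.id k _ := by
  refine SymmetricAlgebra.algHom_ext ((monomialBasis hn hq).ext fun p => ?_)
  change scaleSym hn hq c (scaleSym hn hq d (SymmetricAlgebra.ι k _ (monomialBasis hn hq p))) =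
    SymmetricAlgebra.ι k _ (monomialBasis hn hq p)
  rw [scaleSym_ι_basis, map_smul, scaleSym_ι_basis, smul_smul, ← mul_pow, mul_comm d, h, one_pow,
    one_smul]

/-- The automorphism of the field of fractions that multiplies `t_{x ^ i * y ^ j}` by
`q ^ (i + j)`. -/
noncomputable def scaleFrac :
    FracSym k (TaftAlgebra hn hq) ≃ₐ[k] FracSym k (TaftAlgebra hn hq) :=
  IsFractionRing.algEquivOfAlgEquiv (A := SymmetricAlgebra k (TaftAlgebra hn hq))
    (B := SymmetricAlgebra k (TaftAlgebra hn hq))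
    (AlgEquiv.ofAlgHom (scaleSym hn hq q) (scaleSym hn hq q⁻¹)
      (scaleSym_comp hn hq (mul_inv_cancel₀ (hq.ne_zero (by omega))))
      (scaleSym_comp hn hq (inv_mul_cancel₀ (hq.ne_zero (by omega)))))

/-- Exponents outside the basis range cause no trouble: `q^n = 1` covers `i`, and both sides vanish
for `j ≥ n`. -/
theorem scaleFrac_tMon (i j : ℕ) :
    scaleFrac hn hq (tMon hn hq i j) = q ^ (i + j) • tMon hn hq i j := by
  rcases le_or_gt n j with hj | hj
  · rw [tMon_of_le hn hq i hj, map_zero, smul_zero]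
  have hpow : q ^ (i + j) = q ^ (i % n + j) := by
    rw [pow_add, pow_add]
    congr 1
    conv_lhs => rw [← Nat.mod_add_div i n, pow_add, pow_mul, hq.pow_eq_one, one_pow, mul_one]
  have h : ∀ p : Fin n × Fin n, tMon hn hq p.1 p.2 = algebraMap
      (SymmetricAlgebra k (TaftAlgebra hn hq)) (FracSym k (TaftAlgebra hn hq))
      (SymmetricAlgebra.ι k _ (monomialBasis hn hq p)) := fun p => by
    rw [monomialBasis_apply]
    rfl
  have h1 := h (⟨i % n, Nat.mod_lt _ (by omega)⟩, ⟨j, hj⟩)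
  dsimp only at h1
  rw [hpow, ← tMon_mod, h1, scaleFrac, IsFractionRing.algEquivOfAlgEquiv_algebraMap,
    AlgEquiv.ofAlgHom_apply, scaleSym_ι_basis]
  exact map_smul (IsScalarTower.toAlgHom k (SymmetricAlgebra k (TaftAlgebra hn hq))
    (FracSym k (TaftAlgebra hn hq))) _ _

theorem scaleFrac_tMon_one_pow (i : ℕ) :
    scaleFrac hn hq (tMon hn hq 1 0 ^ i) = q ^ i • tMon hn hq 1 0 ^ i := by
  rw [map_pow, scaleFrac_tMon, smul_pow, add_zero, pow_one]

theorem scaleFrac_ratio (i : ℕ) :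
    scaleFrac hn hq (tMon hn hq i 0 / tMon hn hq 1 0 ^ i) = tMon hn hq i 0 / tMon hn hq 1 0 ^ i := by
  have hq0 : algebraMap k (FracSym k (TaftAlgebra hn hq)) (q ^ i) ≠ 0 := by
    rw [map_ne_zero]
    exact pow_ne_zero _ (hq.ne_zero (by omega))
  rw [map_div₀, scaleFrac_tMon, scaleFrac_tMon_one_pow, Algebra.smul_def, Algebra.smul_def,
    add_zero, mul_div_mul_left _ _ hq0]

theorem scaleFrac_mul_eq_self {i j l : ℕ} (h : n ∣ i + j + l) :
    scaleFrac hn hq (tMon hn hq i j * tMon hn hq l 0) = tMon hn hq i j * tMon hn hq l 0 := by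
  rw [map_mul, scaleFrac_tMon, scaleFrac_tMon, smul_mul_smul_comm, ← pow_add, add_zero,
    (hq.pow_eq_one_iff_dvd _).mpr h, one_smul]

theorem scaleFrac_of_mem_gammaAlgebra {g : FracSym k (TaftAlgebra hn hq)}
    (hg : g ∈ gammaAlgebra hn hq) : scaleFrac hn hq g = g := by
  have h0 : ∀ g ∈ Gamma0 hn hq, scaleFrac hn hq g = g := by
    rintro g (rfl | ⟨i, -, -, rfl⟩)
    · rw [t_x, t_x_pow]
      exact scaleFrac_mul_eq_self hn hq ⟨1, by omega⟩
    · rw [t_x, t_x_pow]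
      exact scaleFrac_ratio hn hq i
  refine AlgHom.adjoin_le_equalizer (scaleFrac hn hq).toAlgHom (AlgHom.id k _) ?_ hg
  rintro g ((hg | ⟨g, hg, rfl⟩) | ⟨i, j, l, -, -, -, -, hmod, rfl⟩)
  · exact h0 g hg
  · change scaleFrac hn hq g⁻¹ = g⁻¹
    rw [map_inv₀, h0 g hg]
  · rw [t_x_pow]
    exact scaleFrac_mul_eq_self hn hq (Nat.modEq_zero_iff_dvd.mp hmod)

end Automorphism

/-! ### The grading by `ZMod n` -/

section Grading

open GenericBase

variable {k : Type*} [Field k] {n : ℕ} {q : k} (hn : 2 ≤ n) (hq : IsPrimitiveRoot q n)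

/-- The homogeneous component of degree `m` of the localization. -/
noncomputable def gradedPiece (m : ZMod n) :
    Submodule k (GenericBase.localization k (TaftAlgebra hn hq)) :=
  ((Subalgebra.toSubmodule (gammaAlgebra hn hq)).comap
    (LinearMap.mulRight k (tMon hn hq 1 0 ^ m.val)⁻¹)).comap
      (GenericBase.localization k (TaftAlgebra hn hq)).val.toLinearMap

theorem mem_gradedPiece {m : ZMod n} {v : GenericBase.localization k (TaftAlgebra hn hq)} :
    v ∈ gradedPiece hn hq m ↔
      (v : FracSym k (TaftAlgebra hn hq)) / tMon hn hq 1 0 ^ m.val ∈ gammaAlgebra hn hq := by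
  rw [div_eq_mul_inv]
  rfl

/-- Any representative of the degree may be used, because `u^n` and its inverse lie in the algebra;
this avoids carries in `val`. -/
theorem mem_gradedPiece_natCast (hn3 : 3 ≤ n) {m : ℕ}
    {v : GenericBase.localization k (TaftAlgebra hn hq)} :
    v ∈ gradedPiece hn hq (m : ZMod n) ↔
      (v : FracSym k (TaftAlgebra hn hq)) / tMon hn hq 1 0 ^ m ∈ gammaAlgebra hn hq := by
  have hu := tMon_ne_zero hn hq 1
  rw [mem_gradedPiece, ZMod.val_natCast]
  have h : (v : FracSym k (TaftAlgebra hn hq)) / tMon hn hq 1 0 ^ (m % n) =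
      v / tMon hn hq 1 0 ^ m * tMon hn hq 1 0 ^ (n * (m / n)) := by
    conv_rhs => rw [← Nat.mod_add_div m n, pow_add, Nat.mod_add_div m n]
    field_simp
  have h' : (v : FracSym k (TaftAlgebra hn hq)) / tMon hn hq 1 0 ^ m =
      v / tMon hn hq 1 0 ^ (m % n) * (tMon hn hq 1 0 ^ (n * (m / n)))⁻¹ := by
    rw [h]
    field_simp
  constructor
  · intro hv
    rw [h']
    exact mul_mem hv (inv_pow_mem_gammaAlgebra hn hq hn3 ⟨_, rfl⟩)
  · intro hv
    rw [h]
    exact mul_mem hv (pow_mem_gammaAlgebra hn hq hn3 ⟨_, rfl⟩)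

theorem gradedMonoid_gradedPiece (hn3 : 3 ≤ n) :
    SetLike.GradedMonoid (gradedPiece hn hq) where
  one_mem := by
    rw [← Nat.cast_zero, mem_gradedPiece_natCast hn hq hn3, pow_zero, div_one]
    exact one_mem _
  mul_mem i j v w hv hw := by
    have : NeZero n := ⟨by omega⟩
    rw [← ZMod.natCast_zmod_val i, mem_gradedPiece_natCast hn hq hn3] at hv
    rw [← ZMod.natCast_zmod_val j, mem_gradedPiece_natCast hn hq hn3] at hw
    rw [← ZMod.natCast_zmod_val i, ← ZMod.natCast_zmod_val j, ← Nat.cast_add,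
      mem_gradedPiece_natCast hn hq hn3, pow_add, MulMemClass.coe_mul, ← div_mul_div_comm]
    exact mul_mem hv hw

theorem map_mem_of_monomial {M : Type*} [AddCommGroup M] [Module k M] (S : Submodule k M)
    (f : TaftAlgebra hn hq →ₗ[k] M) (h : ∀ i j : ℕ, f (x hn hq ^ i * y hn hq ^ j) ∈ S)
    (a : TaftAlgebra hn hq) : f a ∈ S := by
  refine (Submodule.span_le (p := S.comap f)).mpr ?_ ((monomialBasis hn hq).mem_span a)
  rintro _ ⟨p, rfl⟩
  rw [monomialBasis_apply]
  exact h _ _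

theorem iSup_gradedPiece (hn3 : 3 ≤ n) : iSup (gradedPiece hn hq) = ⊤ := by
  have hgr := gradedMonoid_gradedPiece hn hq hn3
  have hu := tMon_ne_zero hn hq 1
  let ℓ := (GenericBase.localization k (TaftAlgebra hn hq)).val
  have hmul : iSup (gradedPiece hn hq) * iSup (gradedPiece hn hq) ≤ iSup (gradedPiece hn hq) := by
    rw [Submodule.iSup_mul]
    refine iSup_le fun i => ?_
    rw [Submodule.mul_iSup]
    refine iSup_le fun j => Submodule.mul_le.mpr fun v hv w hw => ?_
    exact Submodule.mem_iSup_of_mem (i + j) (hgr.mul_mem hv hw)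
  let P : Subalgebra k (GenericBase.localization k (TaftAlgebra hn hq)) :=
    (iSup (gradedPiece hn hq)).toSubalgebra
      (Submodule.mem_iSup_of_mem 0 hgr.one_mem)
      (fun v w hv hw => hmul (Submodule.mul_mem_mul hv hw))
  -- The generators live in the field of fractions, so the comparison is made there and pulled back
  -- along the inclusion.
  have hP : GenericBase.localization k (TaftAlgebra hn hq) ≤ P.map ℓ := by
    refine Algebra.adjoin_le ?_
    rintro _ (⟨a, rfl⟩ | ⟨a, rfl⟩)
    · refine map_mem_of_monomial hn hq (Subalgebra.toSubmodule (P.map ℓ)) _ (fun i j => ?_) a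
      refine ⟨tLoc k _ (x hn hq ^ i * y hn hq ^ j),
        Submodule.mem_iSup_of_mem ((i + j : ℕ) : ZMod n) ?_, rfl⟩
      rw [mem_gradedPiece_natCast hn hq hn3]
      exact tMon_div_pow_mem_gammaAlgebra hn hq hn3 i j
    · refine map_mem_of_monomial hn hq (Subalgebra.toSubmodule (P.map ℓ)) _ (fun i j => ?_) a
      -- The degree is `-i`, written as the natural number `(n - 1) * i`.
      refine ⟨⟨tInvMon hn hq i j, Algebra.subset_adjoin (Or.inr ⟨_, rfl⟩)⟩,
        Submodule.mem_iSup_of_mem (((n - 1) * i : ℕ) : ZMod n) ?_, rfl⟩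
      rw [mem_gradedPiece_natCast hn hq hn3]
      have h := mul_mem (tInvMon_mul_pow_mem_gammaAlgebra hn hq hn3 i j)
        (inv_pow_mem_gammaAlgebra hn hq hn3 (m := n * i) ⟨_, rfl⟩)
      convert h using 1
      rw [show n * i = (n - 1) * i + i by
        rw [← Nat.succ_mul, Nat.succ_eq_add_one, Nat.sub_add_cancel (by omega)], pow_add]
      field_simp
  refine eq_top_iff.mpr fun v _ => ?_
  obtain ⟨w, hw, hwv⟩ := hP v.2
  rwa [← Subtype.ext (p := (· ∈ GenericBase.localization k (TaftAlgebra hn hq))) hwv]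

/-- Each piece lies in an eigenspace of `scaleFrac`, and the eigenvalues `q^m`, `m < n`, are
distinct. -/
theorem iSupIndep_gradedPiece : iSupIndep (gradedPiece hn hq) := by
  have : NeZero n := ⟨by omega⟩
  have hu := tMon_ne_zero hn hq 1
  let ℓ := (GenericBase.localization k (TaftAlgebra hn hq)).val
  let E : ZMod n → Submodule k (FracSym k (TaftAlgebra hn hq)) := fun m =>
    Module.End.eigenspace (scaleFrac hn hq).toLinearMap (q ^ m.val)
  have hE : iSupIndep E := (Module.End.eigenspaces_iSupIndep _).comp fun a b hab =>
    ZMod.val_injective n (hq.pow_inj (ZMod.val_lt a) (ZMod.val_lt b) hab)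
  have hle : ∀ m, (gradedPiece hn hq m).map ℓ.toLinearMap ≤ E m := by
    rintro m _ ⟨v, hv, rfl⟩
    have h := scaleFrac_of_mem_gammaAlgebra hn hq ((mem_gradedPiece hn hq).mp hv)
    rw [Module.End.mem_eigenspace_iff]
    change scaleFrac hn hq (v : FracSym k (TaftAlgebra hn hq)) = _ • (v : FracSym k (TaftAlgebra hn hq))
    have hv' : (v : FracSym k (TaftAlgebra hn hq)) =
        v / tMon hn hq 1 0 ^ m.val * tMon hn hq 1 0 ^ m.val := by field_simp
    conv_lhs => rw [hv', map_mul, h, scaleFrac_tMon_one_pow, mul_smul_comm, ← hv']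
  intro m
  rw [Submodule.disjoint_def]
  intro v hv hv'
  have h1 := hle m ⟨v, hv, rfl⟩
  have h2 := Submodule.mem_map_of_mem (f := ℓ.toLinearMap) hv'
  simp only [Submodule.map_iSup] at h2
  have h3 := (Submodule.disjoint_def.mp (hE m)) _ h1
    ((iSup_mono fun j => iSup_mono fun _ => hle j) h2)
  exact Subtype.ext h3

theorem nonempty_gradedAlgebra (hn3 : 3 ≤ n) : Nonempty (GradedAlgebra (gradedPiece hn hq)) :=
  ⟨{ gradedMonoid_gradedPiece hn hq hn3,
      (DirectSum.isInternal_submodule_of_iSupIndep_of_iSup_eq_top (iSupIndep_gradedPiece hn hq)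
        (iSup_gradedPiece hn hq hn3)).chooseDecomposition with }⟩

/-- The only denominators are products of the `t_{x^i}`, whose inverses are the `t⁻¹_{x^i}`. -/
theorem gammaAlgebra_le_localization :
    gammaAlgebra hn hq ≤ GenericBase.localization k (TaftAlgebra hn hq) := by
  have ht : ∀ a, t k (TaftAlgebra hn hq) a ∈ GenericBase.localization k (TaftAlgebra hn hq) :=
    fun a => Algebra.subset_adjoin (Or.inl ⟨a, rfl⟩)
  have hinv : ∀ i, (t k (TaftAlgebra hn hq) (x hn hq ^ i))⁻¹ ∈
      GenericBase.localization k (TaftAlgebra hn hq) := fun i => by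
    rw [← tInv_x_pow]
    exact Algebra.subset_adjoin (Or.inr ⟨_, rfl⟩)
  have hinv1 : (t k (TaftAlgebra hn hq) (x hn hq))⁻¹ ∈
      GenericBase.localization k (TaftAlgebra hn hq) := by simpa using hinv 1
  refine Algebra.adjoin_le ?_
  rintro g (((rfl | ⟨i, -, -, rfl⟩) | ⟨g, (rfl | ⟨i, -, -, rfl⟩), rfl⟩) |
    ⟨i, j, l, -, -, -, -, -, rfl⟩)
  · exact mul_mem (ht _) (ht _)
  · rw [div_eq_mul_inv, ← inv_pow]
    exact mul_mem (ht _) (pow_mem hinv1 _)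
  · rw [mul_inv]
    exact mul_mem hinv1 (hinv _)
  · rw [inv_div, div_eq_mul_inv]
    exact mul_mem (pow_mem (ht _) _) (hinv _)
  · exact mul_mem (ht _) (ht _)

theorem map_gradedPiece_zero (hn3 : 3 ≤ n) : (gradedPiece hn hq 0).map
    (GenericBase.localization k (TaftAlgebra hn hq)).val.toLinearMap =
      Subalgebra.toSubmodule (gammaAlgebra hn hq) := by
  refine le_antisymm ?_ fun g hg => ?_
  · rintro _ ⟨v, hv, rfl⟩
    rw [SetLike.mem_coe, ← Nat.cast_zero, mem_gradedPiece_natCast hn hq hn3, pow_zero,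
      div_one] at hv
    exact hv
  · refine ⟨⟨g, gammaAlgebra_le_localization hn hq hg⟩, ?_, rfl⟩
    rw [SetLike.mem_coe, ← Nat.cast_zero, mem_gradedPiece_natCast hn hq hn3, pow_zero, div_one]
    exact hg

end Grading

/-! ### Algebraic independence of `Γ₀ ∪ Γ₁` -/

section Independence

open GenericBase

variable {k : Type*} [Field k] {n : ℕ} {q : k} (hn : 2 ≤ n) (hq : IsPrimitiveRoot q n)

/-- The elements of `Γ₀ ∪ Γ₁`, indexed by the monomials `x ^ i * y ^ j`. -/
noncomputable def gammaFamily (p : Fin n × Fin n) : FracSym k (TaftAlgebra hn hq) :=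
  if (p.2 : ℕ) = 0 then
    -- The ratio for `i = 1` would be `1`; its slot is taken by `t_x t_{x^(n-1)}`.
    if (p.1 : ℕ) = 1 then tMon hn hq 1 0 * tMon hn hq (n - 1) 0
    else tMon hn hq p.1 0 / tMon hn hq 1 0 ^ (p.1 : ℕ)
  -- Using `2 * n` keeps the natural subtraction from truncating; the residue is the only admissible
  -- `l`.
  else tMon hn hq p.1 p.2 * tMon hn hq ((2 * n - p.1 - p.2) % n) 0

theorem range_gammaFamily : Set.range (gammaFamily hn hq) = Gamma0 hn hq ∪ Gamma1 hn hq := by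
  apply Set.Subset.antisymm
  · rintro _ ⟨⟨⟨i, hi⟩, ⟨j, hj⟩⟩, rfl⟩
    simp only [gammaFamily]
    split_ifs with hj0 hi1
    · exact Or.inl (prod_mem_Gamma0 hn hq)
    · exact Or.inl (ratio_mem_Gamma0 hn hq hi hi1)
    · refine Or.inr ⟨i, j, _, hi, hj, Nat.mod_lt (2 * n - i - j) (by omega), hj0, ?_, ?_⟩
      · refine ((Nat.mod_modEq (2 * n - i - j) n).add_left (i + j)).trans ?_
        rw [Nat.modEq_zero_iff_dvd]
        exact ⟨2, by omega⟩
      · rw [t_x_pow, tMon]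
  · rintro g ((rfl | ⟨i, hi, hi1, rfl⟩) | ⟨i, j, l, hi, hj, hl, hj0, hmod, rfl⟩)
    · refine ⟨(⟨1, by omega⟩, ⟨0, by omega⟩), ?_⟩
      simp [gammaFamily, t_x, t_x_pow]
    · refine ⟨(⟨i, hi⟩, ⟨0, by omega⟩), ?_⟩
      simp [gammaFamily, t_x, t_x_pow, hi1]
    · refine ⟨(⟨i, hi⟩, ⟨j, hj⟩), ?_⟩
      have hl' : (2 * n - i - j) % n = l := by
        rw [← Nat.mod_eq_of_lt hl]
        refine Nat.ModEq.add_left_cancel' (i + j) (Nat.ModEq.trans ?_ hmod.symm)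
        rw [Nat.modEq_zero_iff_dvd]
        exact ⟨2, by omega⟩
      simp only [gammaFamily, if_neg hj0, hl', t_x_pow, tMon]

/-- `u` is algebraic because `u^n` is a quotient of elements of `Γ₀`; then so are the `t_{x^i}`, by
the ratios, and the other `t_{x^i y^j}`, by `Γ₁`. -/
theorem isAlgebraic_tMon (hn3 : 3 ≤ n) (i j : ℕ) :
    IsAlgebraic (Algebra.adjoin k (Gamma0 hn hq ∪ Gamma1 hn hq)) (tMon hn hq i j) := by
  have hu := tMon_ne_zero hn hq 1
  set S := Algebra.adjoin k (Gamma0 hn hq ∪ Gamma1 hn hq) with hS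
  have hmem : ∀ {g}, g ∈ Gamma0 hn hq ∪ Gamma1 hn hq → IsAlgebraic S g := fun {g} hg =>
    isAlgebraic_algebraMap (⟨g, Algebra.subset_adjoin hg⟩ : S)
  have hone : IsAlgebraic S (tMon hn hq 1 0) := by
    refine IsAlgebraic.of_pow (n := n) (by omega) ?_
    rw [pow_eq_prod_div_ratio, div_eq_mul_inv]
    exact (hmem (Or.inl (prod_mem_Gamma0 hn hq))).mul
      (hmem (Or.inl (ratio_mem_Gamma0 hn hq (by omega) (by omega)))).inv
  have hzero : ∀ i < n, IsAlgebraic S (tMon hn hq i 0) := by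
    intro i hi
    by_cases hi1 : i = 1
    · rwa [hi1]
    · have h := (hmem (Or.inl (ratio_mem_Gamma0 hn hq hi hi1))).mul (hone.pow i)
      rwa [div_mul_cancel₀ _ (pow_ne_zero _ hu)] at h
  rcases le_or_gt n j with hj | hj
  · rw [tMon_of_le hn hq i hj]
    exact isAlgebraic_zero
  rw [← tMon_mod]
  have hi := Nat.mod_lt i (show 0 < n by omega)
  by_cases hj0 : j = 0
  · rw [hj0]
    exact hzero _ hi
  · have hl := Nat.mod_lt (2 * n - i % n - j) (show 0 < n by omega)
    have h : gammaFamily hn hq (⟨i % n, hi⟩, ⟨j, hj⟩) ∈ Gamma0 hn hq ∪ Gamma1 hn hq :=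
      range_gammaFamily hn hq ▸ Set.mem_range_self _
    simp only [gammaFamily, if_neg hj0] at h
    have h' := (hmem h).mul (hzero _ hl).inv
    rwa [mul_inv_cancel_right₀ (tMon_ne_zero hn hq _)] at h'

/-- A family over which the field is algebraic contains a transcendence basis; having no more
members than the transcendence degree, it is one. -/
theorem isTranscendenceBasis_gammaFamily (hn3 : 3 ≤ n) :
    IsTranscendenceBasis k (gammaFamily hn hq) := by
  have hB := isTranscendenceBasis_t hn hq
  have : Algebra.IsAlgebraic (Algebra.adjoin k (Set.range (gammaFamily hn hq)))
      (FracSym k (TaftAlgebra hn hq)) := by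
    rw [range_gammaFamily]
    exact hB.isAlgebraic_iff.mpr fun p => isAlgebraic_tMon hn hq hn3 p.1 p.2
  exact Algebra.IsAlgebraic.isTranscendenceBasis_of_lift_le_trdeg_of_finite k _
    hB.lift_cardinalMk_eq_trdeg.le

end Independence

end Taft

theorem mainTheorem1 {k : Type*} [Field k] [CharZero k] (n : ℕ) (hn : 2 ≤ n) (q : k)
    (hq : IsPrimitiveRoot q n) (hn3 : 3 ≤ n) :
    -- (a) `Γ₀ ∪ Γ₁` has `n ^ 2` elements, and they are algebraically independent
    ((Taft.Gamma0 hn hq ∪ Taft.Gamma1 hn hq).ncard = n ^ 2 ∧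
      AlgebraicIndepOn k id (Taft.Gamma0 hn hq ∪ Taft.Gamma1 hn hq)) ∧
    -- (b) the generic base algebra is `k[Γ₀, Γ₀⁻¹, Γ₁]`
    GenericBase.baseAlgebra k (TaftAlgebra hn hq) =
      Algebra.adjoin k (Taft.Gamma0 hn hq ∪ Taft.Gamma0Inv hn hq ∪ Taft.Gamma1 hn hq) ∧
    -- and it is the degree-zero part of `S(t_H)_Θ` for the `ℤ/n`-grading such that
    -- `t_{x^i y^j}` has degree `i + j`
    ∃ 𝒜 : ZMod n → Submodule k (GenericBase.localization k (TaftAlgebra hn hq)),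
      Nonempty (GradedAlgebra 𝒜) ∧
      (∀ i < n, ∀ j < n,
        GenericBase.tLoc k _ (Taft.x hn hq ^ i * Taft.y hn hq ^ j) ∈ 𝒜 ((i + j : ℕ) : ZMod n)) ∧
      Subalgebra.toSubmodule (GenericBase.baseAlgebra k (TaftAlgebra hn hq)) =
        (𝒜 0).map (GenericBase.localization k (TaftAlgebra hn hq)).val.toLinearMap := by
  have hΓ := Taft.isTranscendenceBasis_gammaFamily hn hq hn3
  refine ⟨⟨?_, ?_⟩, Taft.baseAlgebra_eq_gammaAlgebra hn hq hn3, Taft.gradedPiece hn hq,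
    Taft.nonempty_gradedAlgebra hn hq hn3, ?_, ?_⟩
  · rw [← Taft.range_gammaFamily, ← Set.image_univ,
      Set.ncard_image_of_injective _ hΓ.1.injective, Set.ncard_univ, Nat.card_prod, Nat.card_fin,
      sq]
  · rw [← Taft.range_gammaFamily]
    exact hΓ.1.to_subtype_range
  · intro i _ j _
    rw [Taft.mem_gradedPiece_natCast hn hq hn3]
    exact Taft.tMon_div_pow_mem_gammaAlgebra hn hq hn3 i j
  · rw [Taft.map_gradedPiece_zero hn hq hn3, Taft.baseAlgebra_eq_gammaAlgebra hn hq hn3]
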